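/- Let $n\ge 2$ and $\sigma\in(0,1)$, write points of $\mathbb R^n$ as $x=(x',x_n)$ with $x'\in\mathbb R^{n-1}$, $x_n\in\mathbb R$, and let $\mathbb R^n_+=\{x\in\mathbb R^n: x_n>0\}$. For a measurable function $u:\mathbb R^n_+\to\mathbb R$ put $$I[u]=I_{n,\sigma,\mathbb R^n_+}[u]:=\iint_{\mathbb R^n_+\times\mathbb R^n_+}\frac{(u(x)-u(y))^2}{|x-y|^{n+2\sigma}}\,dx\,dy\in[0,\infty].$$ Let $\mathring H^\sigma(\mathbb R^n_+)$ be the completion of $C_c^\infty(\mathbb R^n_+)$ with respect to $I[\cdot]^{1/2}$, realized as a space of functions in $L^{2n/(n-2\sigma)}(\mathbb R^n_+)$; that is, the set of all $u\in L^{2n/(n-2\sigma)}(\mathbb R^n_+)$ with $I[u]<\infty$ for which there are $\varphi_k\in C_c^\infty(\mathbb R^n_+)$ with $I[u-\varphi_k]\to0$. For a function $f$ on $\mathbb R^{n-1}$ all of whose superlevel sets $\{|f|>t\}$, $t>0$, have finite Lebesgue measure, let $f^*(x')=\int_0^\infty \mathbf 1_{\{|f|>t\}^*}(x')\,dt$ be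 its symmetric decreasing rearrangement, where $A^*$ is the open ball in $\mathbb R^{n-1}$ centred at the origin with the same Lebesgue measure as $A$. Put $$u^\sharp(x',x_n):=\big(u(\cdot,x_n)\big)^*(x').$$ Let $u\in\mathring H^\sigma(\mathbb R^n_+)$. Then for a.e. $x_n>0$ the sets $\{x'\in\mathbb R^{n-1}:|u(x',x_n)|>\lambda\}$ have finite measure for every $\lambda>0$, so that $u^\sharp$ is defined almost everywhere on $\mathbb R^n_+$; it is (Lebesgue) measurable, and $$I_{n,\sigma,\mathbb R^n_+}[u]\ \ge\ I_{n,\sigma,\mathbb R^n_+}[u^\sharp].$$ Moreover, if equality holds, then there is an $a'\in\mathbb R^{n-1}$ such that either $$u(x',x_n)=u^\sharp(x'-a',x_n)\quad\text{for a.e. }(x',x_n)\in\mathbb R^n_+$$ or $$u(x',x_n)=-u^\sharp(x'-a',x_n)\quad\text{for a.e. }(x',x_n)\in\mathbb R^n_+.$$ -/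

import Mathlib

open MeasureTheory Set Filter Topology
open scoped ENNReal ContDiff

noncomputable section

/-- The horizontal space `ℝ^{n-1}` of the variables `x'`, with its Euclidean norm and Lebesgue
measure. -/
abbrev HorizSpace (n : ℕ) : Type := EuclideanSpace ℝ (Fin (n - 1))

/-- `ℝ^n` (for `n ≥ 1`), with points written as `x = (x', x_n)`. Its `volume` is the product of the
Lebesgue measures, that is, `n`-dimensional Lebesgue measure; smoothness and compactness do not
depend on the choice of a norm. The `Prod` norm is the maximum norm, so Euclidean distances are
taken through `euclDist` below. -/
abbrev SplitSpace (n : ℕ) : Type := HorizSpace n × ℝ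

/-- The open upper half space `ℝ^n_+ = {(x', x_n) : x_n > 0}`. -/
def upperHalf (n : ℕ) : Set (SplitSpace n) := {x | 0 < x.2}

/-- The Euclidean distance `|x - y| = (|x' - y'|² + (x_n - y_n)²)^{1/2}` on `ℝ^n`. -/
def euclDist {n : ℕ} (x y : SplitSpace n) : ℝ :=
  Real.sqrt (‖x.1 - y.1‖ ^ 2 + (x.2 - y.2) ^ 2)

/-- The regional fractional seminorm
`I_{n,σ,Ω}[u] = ∬_{Ω×Ω} (u(x) - u(y))² / |x - y|^{n+2σ} dx dy`, with values in `[0, ∞]`. -/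
def regionalEnergy (n : ℕ) (σ : ℝ) (Ω : Set (SplitSpace n)) (u : SplitSpace n → ℝ) : ℝ≥0∞ :=
  ∫⁻ x in Ω, ∫⁻ y in Ω,
    ENNReal.ofReal ((u x - u y) ^ 2 / euclDist x y ^ ((n : ℝ) + 2 * σ))

/-- `φ ∈ C_c^∞(Ω)` (extended by zero to `ℝ^n`). -/
structure IsTestFun {n : ℕ} (Ω : Set (SplitSpace n)) (φ : SplitSpace n → ℝ) : Prop where
  smooth : ContDiff ℝ ∞ φ
  hasCompactSupport : HasCompactSupport φ
  tsupport_subset : tsupport φ ⊆ Ω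

/-- Membership in `H̊^σ(ℝ^n_+)`, the completion of `C_c^∞(ℝ^n_+)` with respect to
`I_{n,σ,ℝ^n_+}[·]^{1/2}`, realized as usual as a space of functions in `L^{2n/(n-2σ)}(ℝ^n_+)`:
the functions of finite seminorm in this Lebesgue space that are limits, in the seminorm, of
functions in `C_c^∞(ℝ^n_+)`. Only the values of `u` on the half space matter. -/
structure MemHRing (n : ℕ) (σ : ℝ) (u : SplitSpace n → ℝ) : Prop where
  memLp : MemLp u (ENNReal.ofReal (2 * (n : ℝ) / ((n : ℝ) - 2 * σ)))
    (volume.restrict (upperHalf n))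
  energy_lt_top : regionalEnergy n σ (upperHalf n) u < ⊤
  approx : ∃ φ : ℕ → SplitSpace n → ℝ, (∀ k, IsTestFun (upperHalf n) (φ k)) ∧
    Tendsto (fun k => regionalEnergy n σ (upperHalf n) (fun x => u x - φ k x)) atTop (𝓝 0)

/-- The symmetric rearrangement `A^*` of a set `A`: the open ball centred at the origin that has the
same volume as `A` (a point `x` is in it iff the ball of radius `|x|` has smaller volume). -/
def symmRearrSet {d : ℕ} (A : Set (EuclideanSpace ℝ (Fin d))) : Set (EuclideanSpace ℝ (Fin d)) :=
  {x | volume (Metric.ball (0 : EuclideanSpace ℝ (Fin d)) ‖x‖) < volume A}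

/-- The symmetric decreasing rearrangement `f^*(x) = ∫_0^∞ 1_{{|f|>t}^*}(x) dt`. -/
def symmDecrRearr {d : ℕ} (f : EuclideanSpace ℝ (Fin d) → ℝ)
    (x : EuclideanSpace ℝ (Fin d)) : ℝ≥0∞ :=
  ∫⁻ t in Ioi (0 : ℝ), (symmRearrSet {y | t < |f y|}).indicator (fun _ => (1 : ℝ≥0∞)) x

/-- The slicewise rearrangement `u^♯(x', x_n) = u(·, x_n)^*(x')`. If all sets `{|u(·, x_n)| > t}`,
`t > 0`, have finite measure, then `u(·, x_n)^*` is finite except possibly at the origin, and the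
conversion to a real number changes nothing elsewhere. -/
def sliceRearr {n : ℕ} (u : SplitSpace n → ℝ) (x : SplitSpace n) : ℝ :=
  (symmDecrRearr (fun x' => u (x', x.2)) x.1).toReal

end

/-!
The energy of `u` on the half space is the superposition, over pairs of heights `s ≠ t`, of the
interaction energies `∬ (u(x', s) - u(y', t))² k(|x' - y'|) dx' dy'` of two horizontal slices
(`regionalEnergy_eq_lintegral_sliceEnergy`). Since `s ≠ t`, the kernel `k` is bounded, integrable and
strictly decreasing (`isStrictKernel_sliceKernel`): slicing removes the singularity of the fractional
kernel. As `||a| - |b|| ≤ |a - b|`, it suffices to treat nonnegative functions, and it suffices to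
show that each pair of slices loses energy under rearrangement.

For two nonnegative functions `f`, `g`, the number `(a - b)²` is the area of a square of levels, so
that their interaction energy is an integral over pairs of levels of the energies between a
superlevel set of one function and a sublevel set of the other
(`diffEnergy_eq_lintegral_levelEnergy`). Passing to complements, which is possible because `k` is
integrable, this becomes Riesz's rearrangement inequality for the superlevel sets
(`rieszE_le_rieszE_ball`). No integrability of `f²` is needed.

Riesz's inequality for sets is proved by polarization at hyperplanes that miss the origin.
Polarization increases `∬_{A × B} k(|x - y|)` by a four-point inequality
(`fourSum_le_fourSum_polarize`) and preserves measures, while averaging over all hyperplanes shows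
that some polarization brings `A` closer to the centred ball by a definite amount, unless it is
already close to it (`exists_volume_inter_preimage_hypRefl_ge`). Hence bounded sets can be brought
arbitrarily close to balls, and general sets are exhausted by bounded ones.

If equality holds in Riesz's inequality, then no polarization changes the energy, and strictness of
the four-point inequality implies that `A` and `B` are polarized in the same direction at every
hyperplane (`volume_goodSide_mul_badSide`). Choose as origin a maximum point `c` of
`∫_A e^{-|x-c|} dx + ∫_B e^{-|x-c|} dx`; then the direction is always towards the origin, and the
averaging argument forces `A` and `B` to be balls centred there (`ae_eq_ball_of_rieszE_eq`). Thus in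
the case of equality all superlevel sets of almost all slices of `|u|` are balls with one common
centre (`exists_center_of_regionalEnergy_eq`). Moreover `u` and `|u|` have the same energy, which
forces `u` to have a sign (`ae_abs_eq_or_of_regionalEnergy_eq`).
-/

noncomputable section

/-! ### Reflections in hyperplanes that miss the origin -/

section Reflection

variable {V : Type*} [NormedAddCommGroup V] [InnerProductSpace ℝ V]

/-- The reflection of `x` in the hyperplane through `v` orthogonal to `v` (for `v ≠ 0`). As `v` runs
through the nonzero vectors, this gives every hyperplane that misses the origin. -/
def hypRefl (v x : V) : V := x + (2 * (1 - inner ℝ x v / ‖v‖ ^ 2)) • v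

/-- A signed (unnormalised) distance to the hyperplane through `v` orthogonal to `v`; it is positive
on the side of the origin. -/
def hypSide (v x : V) : ℝ := ‖v‖ ^ 2 - inner ℝ x v

lemma hypRefl_eq {v : V} (hv : v ≠ 0) (x : V) :
    hypRefl v x = x + (2 * hypSide v x / ‖v‖ ^ 2) • v := by
  have : ‖v‖ ^ 2 ≠ 0 := by positivity
  unfold hypRefl hypSide
  congr 2
  field_simp

lemma hypSide_hypRefl {v : V} (hv : v ≠ 0) (x : V) : hypSide v (hypRefl v x) = -hypSide v x := by
  have : ‖v‖ ^ 2 ≠ 0 := by positivity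
  rw [hypRefl_eq hv]
  simp only [hypSide, inner_add_left, real_inner_smul_left, real_inner_self_eq_norm_sq]
  field_simp
  ring

lemma hypRefl_hypRefl {v : V} (hv : v ≠ 0) (x : V) : hypRefl v (hypRefl v x) = x := by
  rw [hypRefl_eq hv (hypRefl v x), hypSide_hypRefl hv, hypRefl_eq hv, add_assoc, ← add_smul]
  simp [neg_div]

lemma norm_sub_hypRefl_sq {v : V} (hv : v ≠ 0) (x y : V) :
    ‖x - hypRefl v y‖ ^ 2 = ‖x - y‖ ^ 2 + 4 * (hypSide v x * hypSide v y) / ‖v‖ ^ 2 := by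
  have h0 : ‖v‖ ^ 2 ≠ 0 := by positivity
  rw [hypRefl_eq hv, ← sub_sub, norm_sub_sq_real]
  simp only [inner_smul_right, norm_smul, mul_pow, Real.norm_eq_abs, sq_abs, inner_sub_left]
  have h1 : inner ℝ x v = ‖v‖ ^ 2 - hypSide v x := by simp [hypSide]
  have h2 : inner ℝ y v = ‖v‖ ^ 2 - hypSide v y := by simp [hypSide]
  rw [h1, h2]
  field_simp
  ring

lemma norm_hypRefl_sq {v : V} (hv : v ≠ 0) (x : V) :
    ‖hypRefl v x‖ ^ 2 = ‖x‖ ^ 2 + 4 * hypSide v x := by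
  have h0 : ‖v‖ ^ 2 ≠ 0 := by positivity
  have := norm_sub_hypRefl_sq hv 0 x
  simp only [zero_sub, norm_neg] at this
  rw [this]
  simp only [hypSide, inner_zero_left, sub_zero]
  field_simp

lemma norm_hypRefl_sub_hypRefl {v : V} (hv : v ≠ 0) (x y : V) :
    ‖hypRefl v x - hypRefl v y‖ = ‖x - y‖ := by
  have h := norm_sub_hypRefl_sq hv (hypRefl v x) y
  have h' := norm_sub_hypRefl_sq hv y x
  rw [hypSide_hypRefl hv] at h
  rw [norm_sub_rev y, norm_sub_rev y] at h'
  have : ‖hypRefl v x - hypRefl v y‖ ^ 2 = ‖x - y‖ ^ 2 := by rw [h, h']; ring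
  exact (sq_eq_sq₀ (norm_nonneg _) (norm_nonneg _)).1 this

lemma norm_hypRefl_sub {v : V} (hv : v ≠ 0) (x y : V) :
    ‖hypRefl v x - y‖ = ‖x - hypRefl v y‖ := by
  rw [← norm_hypRefl_sub_hypRefl hv, hypRefl_hypRefl hv]

lemma norm_le_norm_hypRefl {v : V} (hv : v ≠ 0) {x : V} (h : 0 ≤ hypSide v x) :
    ‖x‖ ≤ ‖hypRefl v x‖ := by
  have := norm_hypRefl_sq hv x
  exact (sq_le_sq₀ (norm_nonneg _) (norm_nonneg _)).1 (by linarith)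

lemma norm_hypRefl_le_norm {v : V} (hv : v ≠ 0) {x : V} (h : hypSide v x ≤ 0) :
    ‖hypRefl v x‖ ≤ ‖x‖ := by
  have := norm_hypRefl_sq hv x
  exact (sq_le_sq₀ (norm_nonneg _) (norm_nonneg _)).1 (by linarith)

/-- Two points of different norms are exchanged by a reflection, whose hyperplane has a distance to
the origin that is controlled from both sides. -/
lemma exists_hypRefl_eq {x y : V} (h : ‖x‖ < ‖y‖) :
    ∃ v : V, v ≠ 0 ∧ hypRefl v x = y ∧ (‖y‖ - ‖x‖) / 2 ≤ ‖v‖ ∧ ‖v‖ ≤ (‖y‖ + ‖x‖) / 2 := by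
  have hne : y - x ≠ 0 := by
    intro h0
    rw [sub_eq_zero] at h0
    simp [h0] at h
  have hD : 0 < ‖y - x‖ := norm_pos_iff.2 hne
  have hx := norm_nonneg x
  set c : ℝ := (‖y‖ ^ 2 - ‖x‖ ^ 2) / (2 * ‖y - x‖ ^ 2) with hc
  have hc0 : 0 < c := by
    apply div_pos _ (by positivity)
    nlinarith
  have hv : c • (y - x) ≠ 0 := smul_ne_zero hc0.ne' hne
  have hn : ‖c • (y - x)‖ = (‖y‖ - ‖x‖) * (‖y‖ + ‖x‖) / (2 * ‖y - x‖) := by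
    rw [norm_smul, Real.norm_eq_abs, abs_of_pos hc0, hc]
    field_simp
    ring
  refine ⟨c • (y - x), hv, ?_, ?_, ?_⟩
  · rw [hypRefl_eq hv]
    have hs : hypSide (c • (y - x)) x = c * ‖y - x‖ ^ 2 / 2 := by
      have h1 : ‖c • (y - x)‖ ^ 2 = c * ((‖y‖ ^ 2 - ‖x‖ ^ 2) / 2) := by
        rw [norm_smul, Real.norm_eq_abs, mul_pow, sq_abs, hc]
        field_simp
      rw [hypSide, h1, inner_smul_right, inner_sub_right, real_inner_self_eq_norm_sq,
        norm_sub_sq_real, real_inner_comm]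
      ring
    have h2 : ‖c • (y - x)‖ ^ 2 = c ^ 2 * ‖y - x‖ ^ 2 := by
      rw [norm_smul, Real.norm_eq_abs, mul_pow, sq_abs]
    rw [hs, h2, smul_smul]
    have : 2 * (c * ‖y - x‖ ^ 2 / 2) / (c ^ 2 * ‖y - x‖ ^ 2) * c = 1 := by
      field_simp
    rw [this, one_smul, add_sub_cancel]
  · rw [hn, div_le_div_iff₀ (by norm_num) (by positivity)]
    have := norm_sub_le y x
    nlinarith
  · rw [hn, div_le_div_iff₀ (by positivity) (by norm_num)]
    have := norm_sub_norm_le y x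
    nlinarith

end Reflection

/-! ### Polarization of sets and the four-point inequality -/

section Polarization

variable {V : Type*} [NormedAddCommGroup V] [InnerProductSpace ℝ V]

/-- The polarization (two-point rearrangement) of `A` at the hyperplane through `v` orthogonal to
`v`: of each pair of points exchanged by the reflection, a point of `A` is moved to the side of the
origin if possible. -/
def polarize (v : V) (A : Set V) : Set V :=
  {x | (0 ≤ hypSide v x ∧ (x ∈ A ∨ hypRefl v x ∈ A)) ∨
    (hypSide v x < 0 ∧ x ∈ A ∧ hypRefl v x ∈ A)}

lemma hypRefl_eq_self {v : V} (hv : v ≠ 0) {x : V} (h : hypSide v x = 0) : hypRefl v x = x := by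
  simp [hypRefl_eq hv, h]

lemma mem_polarize_of_nonneg {v : V} {A : Set V} {x : V} (h : 0 ≤ hypSide v x) :
    x ∈ polarize v A ↔ (x ∈ A ∨ hypRefl v x ∈ A) := by
  simp [polarize, h, not_lt.2 h]

lemma mem_polarize_of_nonpos {v : V} (hv : v ≠ 0) {A : Set V} {x : V} (h : hypSide v x ≤ 0) :
    x ∈ polarize v A ↔ (x ∈ A ∧ hypRefl v x ∈ A) := by
  rcases h.lt_or_eq with h | h
  · simp [polarize, h, not_le.2 h]
  · rw [mem_polarize_of_nonneg h.ge, hypRefl_eq_self hv h]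
    simp

lemma hypRefl_mem_polarize_of_nonneg {v : V} (hv : v ≠ 0) {A : Set V} {x : V}
    (h : 0 ≤ hypSide v x) : hypRefl v x ∈ polarize v A ↔ (x ∈ A ∧ hypRefl v x ∈ A) := by
  rw [mem_polarize_of_nonpos hv (by rw [hypSide_hypRefl hv]; linarith), hypRefl_hypRefl hv,
    and_comm]

lemma hypRefl_mem_polarize_of_nonpos {v : V} (hv : v ≠ 0) {A : Set V} {x : V}
    (h : hypSide v x ≤ 0) : hypRefl v x ∈ polarize v A ↔ (x ∈ A ∨ hypRefl v x ∈ A) := by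
  rw [mem_polarize_of_nonneg (by rw [hypSide_hypRefl hv]; linarith), hypRefl_hypRefl hv, or_comm]

lemma polarize_subset_ball {v : V} (hv : v ≠ 0) {A : Set V} {R : ℝ}
    (hA : A ⊆ Metric.ball 0 R) : polarize v A ⊆ Metric.ball 0 R := by
  intro x hx
  rcases le_total 0 (hypSide v x) with h | h
  · rcases (mem_polarize_of_nonneg h).1 hx with h1 | h1
    · exact hA h1
    · have := hA h1
      rw [mem_ball_zero_iff] at this ⊢
      exact (norm_le_norm_hypRefl hv h).trans_lt this
  · exact hA ((mem_polarize_of_nonpos hv h).1 hx).1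

/-- The sum of `κ(|x - y|)` over those of the four pairs formed by a point `x` or its reflection and
a point `y` or its reflection that lie in `A × B`. -/
def fourSum (κ : ℝ → ℝ≥0∞) (A B : Set V) (v : V) (z : V × V) : ℝ≥0∞ :=
  (A ×ˢ B).indicator (fun z => κ ‖z.1 - z.2‖) z +
  (A ×ˢ B).indicator (fun z => κ ‖z.1 - z.2‖) (hypRefl v z.1, z.2) +
  ((A ×ˢ B).indicator (fun z => κ ‖z.1 - z.2‖) (z.1, hypRefl v z.2) +
  (A ×ˢ B).indicator (fun z => κ ‖z.1 - z.2‖) (hypRefl v z.1, hypRefl v z.2))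

/-- The four-point inequality behind all rearrangement inequalities for polarizations. -/
lemma fourSum_le_fourSum_polarize {κ : ℝ → ℝ≥0∞} (hκ : AntitoneOn κ (Ici 0)) (A B : Set V)
    {v : V} (hv : v ≠ 0) (z : V × V) :
    fourSum κ A B v z ≤ fourSum κ (polarize v A) (polarize v B) v z := by
  classical
  obtain ⟨x, y⟩ := z
  simp only [fourSum, indicator_apply, mem_prod, norm_hypRefl_sub_hypRefl hv,
    norm_hypRefl_sub hv]
  have hs := norm_sub_hypRefl_sq hv x y
  have hle : 0 ≤ hypSide v x * hypSide v y → κ ‖x - hypRefl v y‖ ≤ κ ‖x - y‖ := fun h => by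
    apply hκ (norm_nonneg _) (norm_nonneg _)
    have : 0 ≤ 4 * (hypSide v x * hypSide v y) / ‖v‖ ^ 2 := by positivity
    exact (sq_le_sq₀ (norm_nonneg _) (norm_nonneg _)).1 (by linarith)
  have hge : hypSide v x * hypSide v y ≤ 0 → κ ‖x - y‖ ≤ κ ‖x - hypRefl v y‖ := fun h => by
    apply hκ (norm_nonneg _) (norm_nonneg _)
    have : 4 * (hypSide v x * hypSide v y) / ‖v‖ ^ 2 ≤ 0 :=
      div_nonpos_of_nonpos_of_nonneg (by linarith) (by positivity)
    exact (sq_le_sq₀ (norm_nonneg _) (norm_nonneg _)).1 (by linarith)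
  generalize κ ‖x - y‖ = p at *
  generalize κ ‖x - hypRefl v y‖ = q at *
  rcases le_total 0 (hypSide v x) with hx | hx <;> rcases le_total 0 (hypSide v y) with hy | hy
  · have h := hle (mul_nonneg hx hy)
    simp only [mem_polarize_of_nonneg hx, hypRefl_mem_polarize_of_nonneg hv hx,
      mem_polarize_of_nonneg hy, hypRefl_mem_polarize_of_nonneg hv hy]
    by_cases h1 : x ∈ A <;> by_cases h2 : hypRefl v x ∈ A <;> by_cases h3 : y ∈ B <;>
      by_cases h4 : hypRefl v y ∈ B <;> simp [h1, h2, h3, h4, h, add_comm]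
  · have h := hge (mul_nonpos_of_nonneg_of_nonpos hx hy)
    simp only [mem_polarize_of_nonneg hx, hypRefl_mem_polarize_of_nonneg hv hx,
      mem_polarize_of_nonpos hv hy, hypRefl_mem_polarize_of_nonpos hv hy]
    by_cases h1 : x ∈ A <;> by_cases h2 : hypRefl v x ∈ A <;> by_cases h3 : y ∈ B <;>
      by_cases h4 : hypRefl v y ∈ B <;> simp [h1, h2, h3, h4, h, add_comm]
  · have h := hge (mul_nonpos_of_nonpos_of_nonneg hx hy)
    simp only [mem_polarize_of_nonpos hv hx, hypRefl_mem_polarize_of_nonpos hv hx,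
      mem_polarize_of_nonneg hy, hypRefl_mem_polarize_of_nonneg hv hy]
    by_cases h1 : x ∈ A <;> by_cases h2 : hypRefl v x ∈ A <;> by_cases h3 : y ∈ B <;>
      by_cases h4 : hypRefl v y ∈ B <;> simp [h1, h2, h3, h4, h, add_comm]
  · have h := hle (mul_nonneg_of_nonpos_of_nonpos hx hy)
    simp only [mem_polarize_of_nonpos hv hx, hypRefl_mem_polarize_of_nonpos hv hx,
      mem_polarize_of_nonpos hv hy, hypRefl_mem_polarize_of_nonpos hv hy]
    by_cases h1 : x ∈ A <;> by_cases h2 : hypRefl v x ∈ A <;> by_cases h3 : y ∈ B <;>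
      by_cases h4 : hypRefl v y ∈ B <;> simp [h1, h2, h3, h4, h, add_comm]

/-- Two points on the side of the origin such that `A` contains only the first of them and only the
reflection of the second, and conversely for `B`, make the four-point inequality strict. -/
lemma fourSum_lt_fourSum_polarize {κ : ℝ → ℝ≥0∞} (hκ : StrictAntiOn κ (Ici 0)) {A B : Set V}
    {v : V} (hv : v ≠ 0) {x y : V} (hx : 0 < hypSide v x) (hy : 0 < hypSide v y)
    (h : (x ∈ A ∧ hypRefl v x ∉ A ∧ y ∉ B ∧ hypRefl v y ∈ B) ∨
      (x ∉ A ∧ hypRefl v x ∈ A ∧ y ∈ B ∧ hypRefl v y ∉ B)) :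
    fourSum κ A B v (x, y) < fourSum κ (polarize v A) (polarize v B) v (x, y) := by
  classical
  simp only [fourSum, indicator_apply, mem_prod, norm_hypRefl_sub_hypRefl hv,
    norm_hypRefl_sub hv]
  have hs := norm_sub_hypRefl_sq hv x y
  have hlt : κ ‖x - hypRefl v y‖ < κ ‖x - y‖ := by
    apply hκ (norm_nonneg _) (norm_nonneg _)
    have : 0 < 4 * (hypSide v x * hypSide v y) / ‖v‖ ^ 2 := by positivity
    exact (sq_lt_sq₀ (norm_nonneg _) (norm_nonneg _)).1 (by linarith)
  generalize κ ‖x - y‖ = p at *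
  generalize κ ‖x - hypRefl v y‖ = q at *
  simp only [mem_polarize_of_nonneg hx.le, hypRefl_mem_polarize_of_nonneg hv hx.le,
      mem_polarize_of_nonneg hy.le, hypRefl_mem_polarize_of_nonneg hv hy.le]
  rcases h with ⟨h1, h2, h3, h4⟩ | ⟨h1, h2, h3, h4⟩ <;> simp [h1, h2, h3, h4, hlt]

variable [MeasurableSpace V] [BorelSpace V]

lemma measurable_hypSide (v : V) : Measurable (hypSide v) := by
  unfold hypSide
  have : Continuous fun x : V => ‖v‖ ^ 2 - inner ℝ x v := by fun_prop
  exact this.measurable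

lemma measurable_hypRefl [FiniteDimensional ℝ V] (v : V) : Measurable (hypRefl v) := by
  unfold hypRefl
  have : Continuous fun x : V => x + (2 * (1 - inner ℝ x v / ‖v‖ ^ 2)) • v := by fun_prop
  exact this.measurable

variable [FiniteDimensional ℝ V]

lemma measurePreserving_hypRefl {v : V} (hv : v ≠ 0) :
    MeasurePreserving (hypRefl v) (volume : Measure V) volume := by
  have hi : Isometry (hypRefl v) := Isometry.of_dist_eq fun x y => by
    rw [dist_eq_norm, dist_eq_norm, norm_hypRefl_sub_hypRefl hv]
  let e : V ≃ᵢ V := ⟨⟨hypRefl v, hypRefl v, hypRefl_hypRefl hv, hypRefl_hypRefl hv⟩, hi⟩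
  have h1 : hypRefl v = (fun x => x + e 0) ∘ e.toRealLinearIsometryEquiv := by
    funext x
    simp [e, IsometryEquiv.toRealLinearIsometryEquiv_apply]
  rw [h1]
  exact (measurePreserving_add_right volume (e 0)).comp
    (LinearIsometryEquiv.measurePreserving _)

lemma measurableSet_polarize (v : V) {A : Set V} (hA : MeasurableSet A) :
    MeasurableSet (polarize v A) := by
  have h1 := measurable_hypSide v
  have h2 := measurable_hypRefl v hA
  exact ((measurableSet_le measurable_const h1).inter (hA.union h2)).union
    ((measurableSet_lt h1 measurable_const).inter (hA.inter h2))

/-- An integral is the average of itself and of its reflection. Comparing the symmetrised integrands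
pointwise avoids splitting the space along the hyperplane. -/
lemma lintegral_add_hypRefl {v : V} (hv : v ≠ 0) {f : V → ℝ≥0∞} (hf : Measurable f) :
    ∫⁻ x, (f x + f (hypRefl v x)) = 2 * ∫⁻ x, f x := by
  rw [lintegral_add_left hf, (measurePreserving_hypRefl hv).lintegral_comp hf, two_mul]

lemma indicator_one_eq_ite {α : Type*} (A : Set α) (x : α) [Decidable (x ∈ A)] :
    A.indicator (1 : α → ℝ≥0∞) x = if x ∈ A then 1 else 0 := by
  by_cases h : x ∈ A <;> simp [h]

lemma volume_polarize {v : V} (hv : v ≠ 0) {A : Set V} (hA : MeasurableSet A) :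
    volume (polarize v A) = volume A := by
  classical
  have hp := measurableSet_polarize v hA
  have key : 2 * volume (polarize v A) = 2 * volume A := by
    rw [← lintegral_indicator_one hA, ← lintegral_indicator_one hp,
      ← lintegral_add_hypRefl hv (measurable_one.indicator hA),
      ← lintegral_add_hypRefl hv (measurable_one.indicator hp)]
    congr 1
    funext x
    simp only [indicator_one_eq_ite]
    rcases le_total 0 (hypSide v x) with h | h
    · simp only [mem_polarize_of_nonneg h, hypRefl_mem_polarize_of_nonneg hv h]
      by_cases h1 : x ∈ A <;> by_cases h2 : hypRefl v x ∈ A <;> simp [h1, h2]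
    · simp only [mem_polarize_of_nonpos hv h, hypRefl_mem_polarize_of_nonpos hv h]
      by_cases h1 : x ∈ A <;> by_cases h2 : hypRefl v x ∈ A <;> simp [h1, h2]
  exact (ENNReal.mul_right_inj (by norm_num) (by norm_num)).1 key

/-- Polarization brings `A` closer to the centred ball, by the measure of the set of points of the
ball that it newly occupies. -/
lemma volume_polarize_diff_ball_add_le {v : V} (hv : v ≠ 0) {A : Set V} (hA : MeasurableSet A)
    (r : ℝ) :
    volume (polarize v A \ Metric.ball 0 r) +
      volume ((Metric.ball 0 r \ A) ∩ hypRefl v ⁻¹' (A \ Metric.ball 0 r)) ≤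
      volume (A \ Metric.ball 0 r) := by
  classical
  set b : Set V := Metric.ball 0 r with hb
  have hbm : MeasurableSet b := Metric.isOpen_ball.measurableSet
  have hp := (measurableSet_polarize v hA).diff hbm
  have hq := (hbm.diff hA).inter (measurable_hypRefl v (hA.diff hbm))
  have hb1 : ∀ x, 0 ≤ hypSide v x → hypRefl v x ∈ b → x ∈ b := fun x h h1 => by
    rw [hb, mem_ball_zero_iff] at h1 ⊢
    exact (norm_le_norm_hypRefl hv h).trans_lt h1
  have hb2 : ∀ x, hypSide v x ≤ 0 → x ∈ b → hypRefl v x ∈ b := fun x h h1 => by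
    rw [hb, mem_ball_zero_iff] at h1 ⊢
    exact (norm_hypRefl_le_norm hv h).trans_lt h1
  clear_value b
  clear hb
  have key : 2 * (volume (polarize v A \ b) +
      volume ((b \ A) ∩ hypRefl v ⁻¹' (A \ b))) ≤ 2 * volume (A \ b) := by
    rw [mul_add, ← lintegral_indicator_one (hA.diff hbm), ← lintegral_indicator_one hp,
      ← lintegral_indicator_one hq,
      ← lintegral_add_hypRefl hv (measurable_one.indicator (hA.diff hbm)),
      ← lintegral_add_hypRefl hv (measurable_one.indicator hp),
      ← lintegral_add_hypRefl hv (measurable_one.indicator hq), ← lintegral_add_left]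
    · refine lintegral_mono fun x => ?_
      simp only [indicator_one_eq_ite, Set.mem_sdiff, mem_inter_iff, mem_preimage,
        hypRefl_hypRefl hv]
      rcases le_total 0 (hypSide v x) with h | h
      · have h0 := hb1 x h
        simp only [mem_polarize_of_nonneg h, hypRefl_mem_polarize_of_nonneg hv h]
        by_cases h1 : x ∈ A <;> by_cases h2 : hypRefl v x ∈ A <;> by_cases h3 : x ∈ b <;>
          by_cases h4 : hypRefl v x ∈ b <;>
          simp [h1, h2, h3, h4] <;> simp_all
      · have h0 := hb2 x h
        simp only [mem_polarize_of_nonpos hv h, hypRefl_mem_polarize_of_nonpos hv h]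
        by_cases h1 : x ∈ A <;> by_cases h2 : hypRefl v x ∈ A <;> by_cases h3 : x ∈ b <;>
          by_cases h4 : hypRefl v x ∈ b <;>
          simp [h1, h2, h3, h4] <;> simp_all
    · exact (measurable_one.indicator hp).add
        ((measurable_one.indicator hp).comp (measurable_hypRefl v))
  exact (ENNReal.mul_le_mul_iff_right (by norm_num) (by norm_num)).1 key


/-- The interaction energy `∬_{A × B} κ(|x - y|) dx dy` of two sets. -/
def rieszE (κ : ℝ → ℝ≥0∞) (A B : Set V) : ℝ≥0∞ :=
  ∫⁻ z in A ×ˢ B, κ ‖z.1 - z.2‖ ∂((volume : Measure V).prod volume)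

lemma measurable_kernel {κ : ℝ → ℝ≥0∞} (hκ : Measurable κ) :
    Measurable fun z : V × V => κ ‖z.1 - z.2‖ := by
  have : Continuous fun z : V × V => ‖z.1 - z.2‖ := by fun_prop
  exact hκ.comp this.measurable

lemma measurable_fourSum {κ : ℝ → ℝ≥0∞} (hκ : Measurable κ) {A B : Set V}
    (hA : MeasurableSet A) (hB : MeasurableSet B) (v : V) : Measurable (fourSum κ A B v) := by
  have hF := (measurable_kernel (V := V) hκ).indicator (hA.prod hB)
  have hr := measurable_hypRefl v
  exact (hF.add (hF.comp ((hr.comp measurable_fst).prodMk measurable_snd))).add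
    ((hF.comp (measurable_fst.prodMk (hr.comp measurable_snd))).add
      (hF.comp ((hr.comp measurable_fst).prodMk (hr.comp measurable_snd))))

lemma lintegral_fourSum {κ : ℝ → ℝ≥0∞} (hκ : Measurable κ) {A B : Set V}
    (hA : MeasurableSet A) (hB : MeasurableSet B) {v : V} (hv : v ≠ 0) :
    ∫⁻ z, fourSum κ A B v z ∂((volume : Measure V).prod volume) = 4 * rieszE κ A B := by
  have hF := (measurable_kernel (V := V) hκ).indicator (hA.prod hB)
  have hr := measurePreserving_hypRefl hv
  have hi := MeasurePreserving.id (volume : Measure V)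
  have h1 := (hr.prod hi).lintegral_comp hF
  have h2 := (hi.prod hr).lintegral_comp hF
  have h3 := (hr.prod hr).lintegral_comp hF
  simp only [Prod.map_def, id] at h1 h2 h3
  unfold fourSum
  rw [lintegral_add_left, lintegral_add_left hF, lintegral_add_left, h1, h2, h3,
    lintegral_indicator (hA.prod hB), rieszE]
  · ring
  · exact hF.comp (hi.prod hr).measurable
  · exact hF.add (hF.comp (hr.prod hi).measurable)

lemma rieszE_le_rieszE_polarize {κ : ℝ → ℝ≥0∞} (hm : Measurable κ) (hκ : AntitoneOn κ (Ici 0))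
    {A B : Set V} (hA : MeasurableSet A) (hB : MeasurableSet B) {v : V} (hv : v ≠ 0) :
    rieszE κ A B ≤ rieszE κ (polarize v A) (polarize v B) := by
  refine (ENNReal.mul_le_mul_iff_right (a := 4) (by norm_num) (by norm_num)).1 ?_
  rw [← lintegral_fourSum hm hA hB hv, ← lintegral_fourSum hm (measurableSet_polarize v hA)
    (measurableSet_polarize v hB) hv]
  exact lintegral_mono (fourSum_le_fourSum_polarize hκ A B hv)

/-- The points on the side of the origin that belong to `A` while their reflections do not. -/
def goodSide (v : V) (A : Set V) : Set V := {x | 0 < hypSide v x ∧ x ∈ A ∧ hypRefl v x ∉ A}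

/-- The points on the side of the origin that do not belong to `A` while their reflections do; these
are the points that polarization adds to `A`. -/
def badSide (v : V) (A : Set V) : Set V := {x | 0 < hypSide v x ∧ x ∉ A ∧ hypRefl v x ∈ A}

lemma measurableSet_badSide (v : V) {A : Set V} (hA : MeasurableSet A) :
    MeasurableSet (badSide v A) :=
  (measurableSet_lt measurable_const (measurable_hypSide v)).inter
    (hA.compl.inter (measurable_hypRefl v hA))

/-- If polarization does not change the energy, then the two sets are not strictly polarized in
opposite directions. -/
lemma volume_goodSide_mul_badSide {κ : ℝ → ℝ≥0∞} (hm : Measurable κ)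
    (hκ : StrictAntiOn κ (Ici 0)) {A B : Set V} (hA : MeasurableSet A) (hB : MeasurableSet B)
    {v : V} (hv : v ≠ 0) (hfin : rieszE κ A B ≠ ⊤)
    (heq : rieszE κ (polarize v A) (polarize v B) ≤ rieszE κ A B) :
    volume (goodSide v A) * volume (badSide v B) = 0 ∧
      volume (badSide v A) * volume (goodSide v B) = 0 := by
  have hae := ae_eq_of_ae_le_of_lintegral_le (μ := (volume : Measure V).prod volume)
    (ae_of_all _ (fourSum_le_fourSum_polarize hκ.antitoneOn A B hv))
    (by rw [lintegral_fourSum hm hA hB hv]; exact ENNReal.mul_ne_top (by norm_num) hfin)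
    (measurable_fourSum hm (measurableSet_polarize v hA) (measurableSet_polarize v hB)
      v).aemeasurable
    (by
      rw [lintegral_fourSum hm hA hB hv, lintegral_fourSum hm (measurableSet_polarize v hA)
        (measurableSet_polarize v hB) hv]
      gcongr)
  rw [← Measure.prod_prod, ← Measure.prod_prod]
  constructor
  · refine measure_mono_null ?_ hae
    rintro ⟨x, y⟩ ⟨⟨hx, h1, h2⟩, ⟨hy, h3, h4⟩⟩
    exact (fourSum_lt_fourSum_polarize hκ hv hx hy (.inl ⟨h1, h2, h3, h4⟩)).ne
  · refine measure_mono_null ?_ hae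
    rintro ⟨x, y⟩ ⟨⟨hx, h1, h2⟩, ⟨hy, h3, h4⟩⟩
    exact (fourSum_lt_fourSum_polarize hκ hv hx hy (.inr ⟨h1, h2, h3, h4⟩)).ne

end Polarization

/-! ### Averaging over hyperplanes -/

section Averaging

variable {V : Type*} [NormedAddCommGroup V] [InnerProductSpace ℝ V]

lemma norm_inv_norm_smul_sub_le {δ : ℝ} (hδ : 0 < δ) {v w : V} (hv : δ ≤ ‖v‖) (hw : δ ≤ ‖w‖) :
    ‖‖v‖⁻¹ • v - ‖w‖⁻¹ • w‖ ≤ 2 / δ * ‖v - w‖ := by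
  have hv0 : 0 < ‖v‖ := hδ.trans_le hv
  have hw0 : 0 < ‖w‖ := hδ.trans_le hw
  have h1 : ‖v‖⁻¹ • v - ‖w‖⁻¹ • w = ‖v‖⁻¹ • (v - w) + (‖v‖⁻¹ - ‖w‖⁻¹) • w := by
    rw [smul_sub, sub_smul]; abel
  have h2 : ‖(‖v‖⁻¹ - ‖w‖⁻¹) • w‖ ≤ ‖v‖⁻¹ * ‖v - w‖ := by
    rw [norm_smul, Real.norm_eq_abs, inv_sub_inv hv0.ne' hw0.ne', abs_div,
      abs_of_pos (mul_pos hv0 hw0)]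
    have := abs_norm_sub_norm_le w v
    rw [norm_sub_rev w v] at this
    calc |‖w‖ - ‖v‖| / (‖v‖ * ‖w‖) * ‖w‖ = ‖v‖⁻¹ * |‖w‖ - ‖v‖| := by field_simp
      _ ≤ _ := by gcongr
  have h3 : ‖v‖⁻¹ ≤ δ⁻¹ := inv_anti₀ hδ hv
  calc _ ≤ ‖‖v‖⁻¹ • (v - w)‖ + ‖(‖v‖⁻¹ - ‖w‖⁻¹) • w‖ := by rw [h1]; exact norm_add_le _ _
    _ ≤ ‖v‖⁻¹ * ‖v - w‖ + ‖v‖⁻¹ * ‖v - w‖ := by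
      gcongr
      rw [norm_smul, norm_inv, norm_norm]
    _ ≤ δ⁻¹ * ‖v - w‖ + δ⁻¹ * ‖v - w‖ := by gcongr
    _ = _ := by ring

lemma hypRefl_eq_normalized {v : V} (hv : v ≠ 0) (x : V) :
    hypRefl v x = x + (2 : ℝ) • v - (2 * inner ℝ x (‖v‖⁻¹ • v)) • (‖v‖⁻¹ • v) := by
  have : ‖v‖ ≠ 0 := by positivity
  rw [hypRefl, smul_smul, inner_smul_right, add_sub_assoc, ← sub_smul]
  congr 2
  field_simp

/-- As a function of its hyperplane, a reflection is Lipschitz continuous as long as the hyperplane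
stays away from the origin. -/
lemma dist_hypRefl_le {δ r : ℝ} (hδ : 0 < δ) {x v w : V} (hx : ‖x‖ ≤ r) (hv : δ ≤ ‖v‖)
    (hw : δ ≤ ‖w‖) : dist (hypRefl v x) (hypRefl w x) ≤ (2 + 8 * r / δ) * dist v w := by
  have hv0 : v ≠ 0 := norm_pos_iff.1 (hδ.trans_le hv)
  have hw0 : w ≠ 0 := norm_pos_iff.1 (hδ.trans_le hw)
  have hd := norm_inv_norm_smul_sub_le hδ hv hw
  have hev : ‖‖v‖⁻¹ • v‖ = 1 := by
    rw [norm_smul, norm_inv, norm_norm, inv_mul_cancel₀ (norm_ne_zero_iff.2 hv0)]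
  have hew : ‖‖w‖⁻¹ • w‖ = 1 := by
    rw [norm_smul, norm_inv, norm_norm, inv_mul_cancel₀ (norm_ne_zero_iff.2 hw0)]
  rw [dist_eq_norm, dist_eq_norm, hypRefl_eq_normalized hv0, hypRefl_eq_normalized hw0]
  set e := ‖v‖⁻¹ • v
  set f := ‖w‖⁻¹ • w
  have h1 : x + (2 : ℝ) • v - (2 * inner ℝ x e) • e - (x + (2 : ℝ) • w - (2 * inner ℝ x f) • f) =
      (2 : ℝ) • (v - w) - ((2 * inner ℝ x e) • (e - f) + (2 * inner ℝ x (e - f)) • f) := by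
    rw [inner_sub_right, mul_sub, smul_sub, smul_sub, sub_smul]
    abel
  have h2 : ‖(2 * inner ℝ x e) • (e - f)‖ ≤ 2 * r * ‖e - f‖ := by
    rw [norm_smul, norm_mul]
    have := norm_inner_le_norm (𝕜 := ℝ) x e
    rw [hev, mul_one] at this
    norm_num
    gcongr
    exact this.trans hx
  have h3 : ‖(2 * inner ℝ x (e - f)) • f‖ ≤ 2 * r * ‖e - f‖ := by
    rw [norm_smul, norm_mul, hew, mul_one]
    have := norm_inner_le_norm (𝕜 := ℝ) x (e - f)
    norm_num
    rw [mul_assoc]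
    gcongr
    exact this.trans (by gcongr)
  have hr : 0 ≤ r := (norm_nonneg x).trans hx
  calc _ ≤ ‖(2 : ℝ) • (v - w)‖ + (‖(2 * inner ℝ x e) • (e - f)‖ +
        ‖(2 * inner ℝ x (e - f)) • f‖) := by
          rw [h1]; exact (norm_sub_le _ _).trans (by gcongr; exact norm_add_le _ _)
    _ ≤ 2 * ‖v - w‖ + (2 * r * (2 / δ * ‖v - w‖) + 2 * r * (2 / δ * ‖v - w‖)) := by
          rw [norm_smul, Real.norm_two]
          gcongr
          · exact h2.trans (by gcongr)
          · exact h3.trans (by gcongr)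
    _ = _ := by ring

variable [FiniteDimensional ℝ V] [MeasurableSpace V] [BorelSpace V]

lemma volume_image_le_of_lipschitzOnWith {K : NNReal} {f : V → V} {s : Set V}
    (h : LipschitzOnWith K f s) :
    volume (f '' s) ≤ (K : ℝ≥0∞) ^ Module.finrank ℝ V * volume s := by
  have h1 := Measure.isAddLeftInvariant_eq_smul (volume : Measure V)
    (Measure.hausdorffMeasure (Module.finrank ℝ V))
  have h2 := h.hausdorffMeasure_image_le (d := Module.finrank ℝ V) (by positivity)
  rw [ENNReal.rpow_natCast] at h2
  rw [h1, Measure.smul_apply, Measure.smul_apply, ENNReal.smul_def, ENNReal.smul_def, smul_eq_mul,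
    smul_eq_mul, mul_left_comm]
  gcongr

lemma measurable_hypRefl_uncurry : Measurable fun z : V × V => hypRefl z.1 z.2 := by
  unfold hypRefl
  fun_prop

/-- A quantitative form of the fact that points inside a ball and points outside it can be exchanged
by reflections: some reflection moves a definite amount of `P` into `Q`. It results from averaging
over all hyperplanes with distance to the origin in a compact subinterval of `(0, ∞)`: for fixed `x`,
the Lipschitz map that sends a hyperplane to the reflection of `x` covers `Q`, and so the set of
hyperplanes that reflect `x` into `Q` is not small. -/
lemma exists_volume_inter_preimage_hypRefl_ge (r R : ℝ) {η : ℝ≥0∞} (hη : η ≠ 0) (hη' : η ≠ ⊤) :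
    ∃ c : ℝ≥0∞, c ≠ 0 ∧ ∀ P Q : Set V, MeasurableSet P → MeasurableSet Q →
      P ⊆ Metric.ball 0 r → Q ⊆ Metric.ball 0 R \ Metric.ball 0 r → η ≤ volume P → η ≤ volume Q →
      ∃ v : V, v ≠ 0 ∧ c ≤ volume (P ∩ hypRefl v ⁻¹' Q) := by
  -- Remove a thin shell, so that the hyperplanes in question stay away from the origin.
  obtain ⟨ε, hε, hshell⟩ : ∃ ε : ℝ, 0 < ε ∧
      volume (Metric.ball (0 : V) r \ Metric.ball 0 (r - ε)) < η / 2 := by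
    have ht := tendsto_measure_iInter_atTop (μ := (volume : Measure V))
      (s := fun n : ℕ => Metric.ball (0 : V) r \ Metric.ball 0 (r - 1 / ((n : ℝ) + 1)))
      (fun n => (Metric.isOpen_ball.measurableSet.diff
        Metric.isOpen_ball.measurableSet).nullMeasurableSet)
      (fun m n hmn => sdiff_subset_sdiff_right (Metric.ball_subset_ball (by gcongr)))
      ⟨0, ((measure_mono sdiff_subset).trans_lt measure_ball_lt_top).ne⟩
    have h0 : (⋂ n : ℕ, Metric.ball (0 : V) r \ Metric.ball 0 (r - 1 / ((n : ℝ) + 1))) = ∅ := by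
      refine eq_empty_of_forall_notMem fun x hx => ?_
      rw [mem_iInter] at hx
      have h1 := (hx 0).1
      rw [mem_ball_zero_iff] at h1
      obtain ⟨n, hn⟩ := exists_nat_one_div_lt (sub_pos.2 h1)
      apply (hx n).2
      rw [mem_ball_zero_iff]
      linarith
    rw [h0, measure_empty] at ht
    obtain ⟨n, hn⟩ := (ht.eventually_lt_const (ENNReal.half_pos hη)).exists
    exact ⟨1 / ((n : ℝ) + 1), by positivity, hn⟩
  set M : ℝ := (R + r) / 2
  set W : Set V := Metric.closedBall 0 M \ Metric.ball 0 (ε / 2)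
  have hWm : MeasurableSet W :=
    Metric.isClosed_closedBall.measurableSet.diff Metric.isOpen_ball.measurableSet
  have hWfin : volume W ≠ ⊤ :=
    ((measure_mono sdiff_subset).trans_lt measure_closedBall_lt_top).ne
  have hW0 : ∀ v ∈ W, ε / 2 ≤ ‖v‖ := fun v hv => by
    have := hv.2
    rwa [mem_ball_zero_iff, not_lt] at this
  set L : NNReal := (2 + 8 * r / (ε / 2)).toNNReal
  set Ld : ℝ≥0∞ := (L : ℝ≥0∞) ^ Module.finrank ℝ V
  have hLd : Ld ≠ ⊤ := ENNReal.pow_ne_top ENNReal.coe_ne_top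
  set a : ℝ≥0∞ := η / 2 * (η / (Ld + 1))
  have ha : a ≠ 0 := by
    simp only [a, ne_eq, mul_eq_zero, ENNReal.div_eq_zero_iff, not_or]
    refine ⟨⟨hη, by norm_num⟩, hη, ?_⟩
    simp [hLd]
  have ha' : a ≠ ⊤ := by
    refine ENNReal.mul_ne_top (ENNReal.div_ne_top hη' (by norm_num))
      (ENNReal.div_ne_top hη' (by simp))
  refine ⟨a / 2 / (volume W + 1), ?_, ?_⟩
  · simp [ENNReal.div_eq_zero_iff, ha, hWfin]
  intro P Q hP hQ hPr hQr hPη hQη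
  by_contra! hcon
  set P' := P ∩ Metric.ball 0 (r - ε)
  have hP' : MeasurableSet P' := hP.inter Metric.isOpen_ball.measurableSet
  have hP'η : η / 2 ≤ volume P' := by
    have h1 : volume P ≤ volume P' + η / 2 := by
      refine (measure_mono (t := P' ∪ (Metric.ball (0 : V) r \ Metric.ball 0 (r - ε))) ?_).trans
        ((measure_union_le _ _).trans (by gcongr))
      intro x hx
      by_cases h : x ∈ Metric.ball (0 : V) (r - ε)
      · exact .inl ⟨hx, h⟩
      · exact .inr ⟨hPr hx, h⟩
    have h2 : η / 2 + η / 2 ≤ volume P' + η / 2 := by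
      rw [ENNReal.add_halves]; exact hPη.trans h1
    exact (ENNReal.add_le_add_iff_right (ENNReal.div_ne_top hη' (by norm_num))).1 h2
  have hslice : ∀ x ∈ P', η / (Ld + 1) ≤ volume (W ∩ {v | hypRefl v x ∈ Q}) := by
    intro x hx
    have hxr : ‖x‖ < r - ε := by simpa using hx.2
    have hsub : Q ⊆ (fun v => hypRefl v x) '' (W ∩ {v | hypRefl v x ∈ Q}) := by
      intro y hy
      have hyR : ‖y‖ < R := by simpa using (hQr hy).1
      have hyr : r ≤ ‖y‖ := by simpa using (hQr hy).2
      obtain ⟨v, hv0, hv, h1, h2⟩ := exists_hypRefl_eq (x := x) (y := y) (by linarith)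
      refine ⟨v, ⟨⟨?_, ?_⟩, ?_⟩, hv⟩
      · rw [mem_closedBall_zero_iff]
        simp only [M]
        linarith
      · rw [mem_ball_zero_iff, not_lt]
        linarith
      · simpa [hv] using hy
    have hlip : LipschitzOnWith L (fun v => hypRefl v x) (W ∩ {v | hypRefl v x ∈ Q}) := by
      apply LipschitzOnWith.of_dist_le_mul
      intro v hv w hw
      refine (dist_hypRefl_le (half_pos hε) (x := x) (r := r) (by linarith) (hW0 v hv.1)
        (hW0 w hw.1)).trans ?_
      gcongr
      exact Real.le_coe_toNNReal _
    rw [ENNReal.div_le_iff_le_mul (.inl (by simp)) (.inl (by simp [hLd]))]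
    refine hQη.trans ((measure_mono hsub).trans
      ((volume_image_le_of_lipschitzOnWith hlip).trans ?_))
    rw [mul_comm]
    gcongr
    exact le_self_add
  have hlow : a ≤ ∫⁻ x in P', volume (W ∩ {v | hypRefl v x ∈ Q}) := by
    calc a ≤ ∫⁻ x in P', η / (Ld + 1) := by
          rw [setLIntegral_const, mul_comm]
          exact mul_le_mul_left hP'η _
      _ ≤ _ := setLIntegral_mono' hP' hslice
  have hQm : MeasurableSet {z : V × V | hypRefl z.1 z.2 ∈ Q} := measurable_hypRefl_uncurry hQ
  have hswap : ∫⁻ x in P', volume (W ∩ {v | hypRefl v x ∈ Q}) =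
      ∫⁻ v in W, volume (P' ∩ hypRefl v ⁻¹' Q) := by
    have h1 : ∀ x, volume (W ∩ {v | hypRefl v x ∈ Q}) =
        ∫⁻ v in W, {z : V × V | hypRefl z.1 z.2 ∈ Q}.indicator 1 (v, x) := fun x => by
      rw [inter_comm, ← Measure.restrict_apply' hWm, ← lintegral_indicator_one]
      · rfl
      · exact hQm.preimage measurable_prodMk_right
    have h2 : ∀ v, volume (P' ∩ hypRefl v ⁻¹' Q) =
        ∫⁻ x in P', {z : V × V | hypRefl z.1 z.2 ∈ Q}.indicator 1 (v, x) := fun v => by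
      rw [inter_comm, ← Measure.restrict_apply' hP', ← lintegral_indicator_one]
      · rfl
      · exact measurable_hypRefl v hQ
    simp only [h1, h2]
    rw [lintegral_lintegral_swap]
    exact ((measurable_one.indicator hQm).comp measurable_swap).aemeasurable
  have hup : ∫⁻ v in W, volume (P' ∩ hypRefl v ⁻¹' Q) ≤ a / 2 := by
    calc _ ≤ ∫⁻ v in W, a / 2 / (volume W + 1) := by
          refine setLIntegral_mono' hWm fun v hv => ?_
          have hv0 : v ≠ 0 := norm_pos_iff.1 ((half_pos hε).trans_le (hW0 v hv))
          refine (measure_mono ?_).trans (hcon v hv0).le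
          exact inter_subset_inter_left _ inter_subset_left
      _ = a / 2 / (volume W + 1) * volume W := setLIntegral_const _ _
      _ ≤ a / 2 / (volume W + 1) * (volume W + 1) := by gcongr; exact le_self_add
      _ = a / 2 := ENNReal.div_mul_cancel (by simp) (by simp [hWfin])
  have := (hlow.trans (hswap.trans_le hup)).trans_lt (ENNReal.half_lt_self ha ha')
  exact this.false

lemma exists_volume_inter_preimage_hypRefl_ne_zero {r : ℝ} {P Q : Set V} (hP : MeasurableSet P)
    (hQ : MeasurableSet Q) (hPr : P ⊆ Metric.ball 0 r) (hQr : Disjoint Q (Metric.ball 0 r))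
    (hP0 : volume P ≠ 0) (hQ0 : volume Q ≠ 0) :
    ∃ v : V, v ≠ 0 ∧ volume (P ∩ hypRefl v ⁻¹' Q) ≠ 0 := by
  obtain ⟨n, hn⟩ : ∃ n : ℕ, volume (Q ∩ Metric.ball 0 n) ≠ 0 := by
    by_contra! h
    apply hQ0
    rw [← inter_univ Q, ← Metric.iUnion_ball_nat (0 : V), inter_iUnion]
    exact measure_iUnion_null h
  have hQm := hQ.inter (Metric.isOpen_ball (x := (0 : V)) (ε := n)).measurableSet
  have hPfin : volume P ≠ ⊤ := ((measure_mono hPr).trans_lt measure_ball_lt_top).ne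
  obtain ⟨c, hc, H⟩ := exists_volume_inter_preimage_hypRefl_ge (V := V) r n
    (η := min (volume P) (volume (Q ∩ Metric.ball 0 n))) (by simp [min_eq_iff, hP0, hn])
    (ne_top_of_le_ne_top hPfin (min_le_left _ _))
  obtain ⟨v, hv, h⟩ := H P (Q ∩ Metric.ball 0 n) hP hQm hPr
    (fun x hx => ⟨hx.2, fun h => disjoint_left.1 hQr hx.1 h⟩) (min_le_left _ _) (min_le_right _ _)
  refine ⟨v, hv, fun h0 => hc ?_⟩
  refine le_antisymm (h.trans ?_) bot_le
  rw [← h0]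
  exact measure_mono (inter_subset_inter_right _ (preimage_mono inter_subset_left))

end Averaging

/-! ### Riesz's rearrangement inequality for two sets -/

section RieszInequality

variable {V : Type*} [NormedAddCommGroup V] [InnerProductSpace ℝ V] [FiniteDimensional ℝ V]
  [MeasurableSpace V] [BorelSpace V]

lemma rieszE_mono (κ : ℝ → ℝ≥0∞) {A A' B B' : Set V} (hA : A ⊆ A') (hB : B ⊆ B') :
    rieszE κ A B ≤ rieszE κ A' B' :=
  lintegral_mono_set (prod_mono hA hB)

lemma rieszE_le_mul {κ : ℝ → ℝ≥0∞} {K : ℝ≥0∞} (hK : ∀ ρ, κ ρ ≤ K) (A B : Set V) :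
    rieszE κ A B ≤ K * (volume A * volume B) := by
  rw [← Measure.prod_prod, ← setLIntegral_const]
  exact lintegral_mono fun z => hK _

lemma volume_diff_eq_of_volume_eq {A b : Set V} (hA : MeasurableSet A) (hb : MeasurableSet b)
    (h : volume b = volume A) (hfin : volume A ≠ ⊤) : volume (b \ A) = volume (A \ b) := by
  have h1 := measure_inter_add_sdiff (μ := volume) A hb
  have h2 := measure_inter_add_sdiff (μ := volume) b hA
  have h3 : volume (A ∩ b) ≠ ⊤ := ((measure_mono inter_subset_left).trans_lt hfin.lt_top).ne
  rw [inter_comm, h, ← h1] at h2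
  exact (ENNReal.add_right_inj h3).1 h2

lemma rieszE_le_add {κ : ℝ → ℝ≥0∞} {K : ℝ≥0∞} (hK : ∀ ρ, κ ρ ≤ K) (A B a b : Set V) :
    rieszE κ A B ≤ rieszE κ a b + (K * (volume (A \ a) * volume B) +
      K * (volume a * volume (B \ b))) := by
  have hsub : A ×ˢ B ⊆ a ×ˢ b ∪ ((A \ a) ×ˢ B ∪ a ×ˢ (B \ b)) := by
    rintro ⟨x, y⟩ ⟨hx, hy⟩
    simp only [mem_union, mem_prod, Set.mem_sdiff] at *
    tauto
  calc rieszE κ A B ≤ rieszE κ a b + (rieszE κ (A \ a) B + rieszE κ a (B \ b)) := by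
        refine (lintegral_mono_set hsub).trans ((lintegral_union_le _ _ _).trans ?_)
        exact add_le_add le_rfl (lintegral_union_le _ _ _)
    _ ≤ _ := by
        gcongr
        · exact rieszE_le_mul hK _ _
        · exact rieszE_le_mul hK _ _

/-- Finitely many polarizations bring two bounded sets arbitrarily close to centred balls, without
decreasing their interaction energy. -/
lemma exists_rieszE_le_of_bounded {κ : ℝ → ℝ≥0∞} (hm : Measurable κ) (hκ : AntitoneOn κ (Ici 0))
    {A B : Set V} (hA : MeasurableSet A) (hB : MeasurableSet B) {rA rB R : ℝ}
    (hAr : volume (Metric.ball (0 : V) rA) = volume A)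
    (hBr : volume (Metric.ball (0 : V) rB) = volume B)
    (hAR : A ⊆ Metric.ball 0 R) (hBR : B ⊆ Metric.ball 0 R) {ε : ℝ≥0∞} (hε : ε ≠ 0) :
    ∃ A' B' : Set V, volume A' = volume A ∧ volume B' = volume B ∧
      rieszE κ A B ≤ rieszE κ A' B' ∧
      volume (A' \ Metric.ball 0 rA) + volume (B' \ Metric.ball 0 rB) < ε := by
  have hAfin : volume A ≠ ⊤ := ((measure_mono hAR).trans_lt measure_ball_lt_top).ne
  have hBfin : volume B ≠ ⊤ := ((measure_mono hBR).trans_lt measure_ball_lt_top).ne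
  let S : Set (Set V × Set V) := {p | MeasurableSet p.1 ∧ MeasurableSet p.2 ∧
    volume p.1 = volume A ∧ volume p.2 = volume B ∧ p.1 ⊆ Metric.ball 0 R ∧
    p.2 ⊆ Metric.ball 0 R ∧ rieszE κ A B ≤ rieszE κ p.1 p.2}
  let δ : Set V × Set V → ℝ≥0∞ := fun p =>
    volume (p.1 \ Metric.ball 0 rA) + volume (p.2 \ Metric.ball 0 rB)
  have hS0 : (A, B) ∈ S := ⟨hA, hB, rfl, rfl, hAR, hBR, le_rfl⟩
  have hpol : ∀ p ∈ S, ∀ v : V, v ≠ 0 → (polarize v p.1, polarize v p.2) ∈ S := by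
    rintro ⟨A', B'⟩ ⟨h1, h2, h3, h4, h5, h6, h7⟩ v hv
    exact ⟨measurableSet_polarize v h1, measurableSet_polarize v h2,
      (volume_polarize hv h1).trans h3, (volume_polarize hv h2).trans h4,
      polarize_subset_ball hv h5, polarize_subset_ball hv h6,
      h7.trans (rieszE_le_rieszE_polarize hm hκ h1 h2 hv)⟩
  set m : ℝ≥0∞ := ⨅ p ∈ S, δ p with hmdef
  -- A pair with almost minimal distance could be improved by a definite amount.
  have hm0 : m = 0 := by
    by_contra hm0
    have hmfin : m ≠ ⊤ := by
      refine ne_top_of_le_ne_top (b := δ (A, B)) ?_ (iInf₂_le _ hS0)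
      exact ENNReal.add_ne_top.2 ⟨((measure_mono sdiff_subset).trans_lt hAfin.lt_top).ne,
        ((measure_mono sdiff_subset).trans_lt hBfin.lt_top).ne⟩
    have hη : m / 2 ≠ 0 := (ENNReal.half_pos hm0).ne'
    have hη' : m / 2 ≠ ⊤ := ENNReal.div_ne_top hmfin (by norm_num)
    obtain ⟨cA, hcA, HA⟩ := exists_volume_inter_preimage_hypRefl_ge (V := V) rA R hη hη'
    obtain ⟨cB, hcB, HB⟩ := exists_volume_inter_preimage_hypRefl_ge (V := V) rB R hη hη'
    have hc : min cA cB ≠ 0 := by simp [min_eq_iff, hcA, hcB]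
    obtain ⟨p, hpS, hp⟩ : ∃ p ∈ S, δ p < m + min cA cB := by
      have : m < m + min cA cB := ENNReal.lt_add_right hmfin hc
      rw [hmdef] at this
      simpa only [iInf_lt_iff, exists_prop] using this
    obtain ⟨h1, h2, h3, h4, h5, h6, -⟩ := id hpS
    have hle : ∀ v : V, v ≠ 0 → m ≤ δ (polarize v p.1, polarize v p.2) := fun v hv =>
      iInf₂_le _ (hpol p hpS v hv)
    have hcontra : ∀ v : V, v ≠ 0 →
        δ (polarize v p.1, polarize v p.2) + min cA cB ≤ δ p → False := fun v hv h =>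
      (((add_le_add_left (hle v hv) _).trans h).trans_lt hp).false
    have hbA := (Metric.isOpen_ball (x := (0 : V)) (ε := rA)).measurableSet
    have hbB := (Metric.isOpen_ball (x := (0 : V)) (ε := rB)).measurableSet
    by_cases hcase : m / 2 ≤ volume (p.1 \ Metric.ball 0 rA)
    · obtain ⟨v, hv, h⟩ := HA (Metric.ball 0 rA \ p.1) (p.1 \ Metric.ball 0 rA) (hbA.diff h1)
        (h1.diff hbA) sdiff_subset (fun x hx => ⟨h5 hx.1, hx.2⟩)
        (by rwa [volume_diff_eq_of_volume_eq h1 hbA (hAr.trans h3.symm) (h3 ▸ hAfin)]) hcase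
      refine hcontra v hv ?_
      have g1 := volume_polarize_diff_ball_add_le hv h1 rA
      have g2 := volume_polarize_diff_ball_add_le hv h2 rB
      calc δ (polarize v p.1, polarize v p.2) + min cA cB
          ≤ volume (polarize v p.1 \ Metric.ball 0 rA) +
              volume (polarize v p.2 \ Metric.ball 0 rB) + cA := by
            simp only [δ]; gcongr; exact min_le_left _ _
        _ = (volume (polarize v p.1 \ Metric.ball 0 rA) + cA) +
              volume (polarize v p.2 \ Metric.ball 0 rB) := by ring
        _ ≤ δ p := add_le_add ((add_le_add_right h _).trans g1) (le_self_add.trans g2)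
    · have hcase' : m / 2 ≤ volume (p.2 \ Metric.ball 0 rB) := by
        by_contra hlt
        have h0 : m ≤ δ p := iInf₂_le _ hpS
        have := ENNReal.add_lt_add (not_le.1 hcase) (not_le.1 hlt)
        rw [ENNReal.add_halves] at this
        exact (this.trans_le h0).false
      obtain ⟨v, hv, h⟩ := HB (Metric.ball 0 rB \ p.2) (p.2 \ Metric.ball 0 rB) (hbB.diff h2)
        (h2.diff hbB) sdiff_subset (fun x hx => ⟨h6 hx.1, hx.2⟩)
        (by rwa [volume_diff_eq_of_volume_eq h2 hbB (hBr.trans h4.symm) (h4 ▸ hBfin)]) hcase'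
      refine hcontra v hv ?_
      have g1 := volume_polarize_diff_ball_add_le hv h1 rA
      have g2 := volume_polarize_diff_ball_add_le hv h2 rB
      calc δ (polarize v p.1, polarize v p.2) + min cA cB
          ≤ volume (polarize v p.1 \ Metric.ball 0 rA) +
              volume (polarize v p.2 \ Metric.ball 0 rB) + cB := by
            simp only [δ]; gcongr; exact min_le_right _ _
        _ = volume (polarize v p.1 \ Metric.ball 0 rA) +
              (volume (polarize v p.2 \ Metric.ball 0 rB) + cB) := by ring
        _ ≤ δ p := add_le_add (le_self_add.trans g1) ((add_le_add_right h _).trans g2)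
  obtain ⟨p, hpS, hp⟩ : ∃ p ∈ S, δ p < ε := by
    have : m < ε := hm0 ▸ pos_iff_ne_zero.2 hε
    rw [hmdef] at this
    simpa only [iInf_lt_iff, exists_prop] using this
  exact ⟨p.1, p.2, hpS.2.2.1, hpS.2.2.2.1, hpS.2.2.2.2.2.2, hp⟩

lemma rieszE_le_rieszE_ball_of_bounded {κ : ℝ → ℝ≥0∞} (hm : Measurable κ)
    (hκ : AntitoneOn κ (Ici 0)) {K : ℝ≥0∞} (hK : ∀ ρ, κ ρ ≤ K) (hK' : K ≠ ⊤)
    {A B : Set V} (hA : MeasurableSet A) (hB : MeasurableSet B) {rA rB R : ℝ}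
    (hAr : volume (Metric.ball (0 : V) rA) = volume A)
    (hBr : volume (Metric.ball (0 : V) rB) = volume B)
    (hAR : A ⊆ Metric.ball 0 R) (hBR : B ⊆ Metric.ball 0 R) :
    rieszE κ A B ≤ rieszE κ (Metric.ball (0 : V) rA) (Metric.ball 0 rB) := by
  have hAfin : volume A ≠ ⊤ := ((measure_mono hAR).trans_lt measure_ball_lt_top).ne
  have hBfin : volume B ≠ ⊤ := ((measure_mono hBR).trans_lt measure_ball_lt_top).ne
  have hC : K * volume B + K * volume A ≠ ⊤ :=
    ENNReal.add_ne_top.2 ⟨ENNReal.mul_ne_top hK' hBfin, ENNReal.mul_ne_top hK' hAfin⟩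
  have hle : ∀ ε : ℝ≥0∞, ε ≠ 0 → rieszE κ A B ≤
      rieszE κ (Metric.ball (0 : V) rA) (Metric.ball 0 rB) +
        (K * volume B + K * volume A) * ε := by
    intro ε hε
    obtain ⟨A', B', h1, h2, h3, h4⟩ :=
      exists_rieszE_le_of_bounded hm hκ hA hB hAr hBr hAR hBR hε
    refine h3.trans ((rieszE_le_add hK A' B' (Metric.ball 0 rA) (Metric.ball 0 rB)).trans ?_)
    rw [hAr, h2]
    gcongr
    rw [add_mul]
    refine add_le_add ?_ ?_
    · rw [mul_assoc, mul_comm (volume B)]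
      gcongr
      exact le_self_add.trans h4.le
    · rw [mul_assoc]
      gcongr
      exact le_add_self.trans h4.le
  have ht : Tendsto (fun n : ℕ => rieszE κ (Metric.ball (0 : V) rA) (Metric.ball 0 rB) +
      (K * volume B + K * volume A) * (n : ℝ≥0∞)⁻¹) atTop
      (𝓝 (rieszE κ (Metric.ball (0 : V) rA) (Metric.ball 0 rB) +
        (K * volume B + K * volume A) * 0)) :=
    tendsto_const_nhds.add (ENNReal.Tendsto.const_mul ENNReal.tendsto_inv_nat_nhds_zero (.inr hC))
  rw [mul_zero, add_zero] at ht
  exact ge_of_tendsto' ht fun n => hle _ (by simp)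

lemma exists_volume_ball_eq [Nontrivial V] {m : ℝ≥0∞} (hm : m ≠ ⊤) :
    ∃ r : ℝ, 0 ≤ r ∧ volume (Metric.ball (0 : V) r) = m := by
  set β : ℝ≥0∞ := volume (Metric.ball (0 : V) 1)
  have hb : β ≠ 0 := (Metric.measure_ball_pos _ _ one_pos).ne'
  have hb' : β ≠ ⊤ := measure_ball_lt_top.ne
  have hd : Module.finrank ℝ V ≠ 0 := Module.finrank_pos.ne'
  refine ⟨((m / β).toReal) ^ ((Module.finrank ℝ V : ℝ)⁻¹), by positivity, ?_⟩
  rw [Measure.addHaar_ball _ _ (by positivity), Real.rpow_inv_natCast_pow (by positivity) hd,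
    ENNReal.ofReal_toReal (ENNReal.div_ne_top hm hb), ENNReal.div_mul_cancel hb hb']

lemma volume_ball_lt_iff [Nontrivial V] {r s : ℝ} (hr : 0 ≤ r) (hs : 0 ≤ s) :
    volume (Metric.ball (0 : V) r) < volume (Metric.ball (0 : V) s) ↔ r < s := by
  have hb : volume (Metric.ball (0 : V) 1) ≠ 0 := (Metric.measure_ball_pos _ _ one_pos).ne'
  have hb' : volume (Metric.ball (0 : V) 1) ≠ ⊤ := measure_ball_lt_top.ne
  have hd : Module.finrank ℝ V ≠ 0 := Module.finrank_pos.ne'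
  rw [Measure.addHaar_ball _ _ hr, Measure.addHaar_ball _ _ hs,
    ENNReal.mul_lt_mul_iff_left hb hb']
  rw [ENNReal.ofReal_lt_ofReal_iff_of_nonneg (by positivity), pow_lt_pow_iff_left₀ hr hs hd]

/-- **Riesz's rearrangement inequality** for two sets of finite measure and a bounded, radially
decreasing kernel. -/
theorem rieszE_le_rieszE_ball [Nontrivial V] {κ : ℝ → ℝ≥0∞} (hm : Measurable κ)
    (hκ : AntitoneOn κ (Ici 0)) {K : ℝ≥0∞} (hK : ∀ ρ, κ ρ ≤ K) (hK' : K ≠ ⊤)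
    {A B : Set V} (hA : MeasurableSet A) (hB : MeasurableSet B) {rA rB : ℝ}
    (hrA : 0 ≤ rA) (hrB : 0 ≤ rB)
    (hAr : volume (Metric.ball (0 : V) rA) = volume A)
    (hBr : volume (Metric.ball (0 : V) rB) = volume B) :
    rieszE κ A B ≤ rieszE κ (Metric.ball (0 : V) rA) (Metric.ball 0 rB) := by
  have hAfin : volume A ≠ ⊤ := by rw [← hAr]; exact measure_ball_lt_top.ne
  have hBfin : volume B ≠ ⊤ := by rw [← hBr]; exact measure_ball_lt_top.ne
  have hrad : ∀ (C : Set V) (r : ℝ) (n : ℕ), volume C ≠ ⊤ → 0 ≤ r →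
      volume (Metric.ball (0 : V) r) = volume C →
      ∃ s, volume (Metric.ball (0 : V) s) = volume (C ∩ Metric.ball 0 n) ∧
        Metric.ball (0 : V) s ⊆ Metric.ball 0 r := by
    intro C r n hC hr hCr
    have hle : volume (C ∩ Metric.ball 0 n) ≤ volume C := measure_mono inter_subset_left
    obtain ⟨s, hs0, hs⟩ := exists_volume_ball_eq (V := V) (ne_top_of_le_ne_top hC hle)
    refine ⟨s, hs, Metric.ball_subset_ball ?_⟩
    by_contra! hlt
    have := (volume_ball_lt_iff (V := V) hr hs0).2 hlt
    rw [hs, hCr] at this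
    exact (this.trans_le hle).false
  have hbd : ∀ n : ℕ, rieszE κ (A ∩ Metric.ball 0 n) (B ∩ Metric.ball 0 n) ≤
      rieszE κ (Metric.ball (0 : V) rA) (Metric.ball 0 rB) := by
    intro n
    obtain ⟨s, hs, hs'⟩ := hrad A rA n hAfin hrA hAr
    obtain ⟨t, ht, ht'⟩ := hrad B rB n hBfin hrB hBr
    have hb := (Metric.isOpen_ball (x := (0 : V)) (ε := n)).measurableSet
    exact (rieszE_le_rieszE_ball_of_bounded hm hκ hK hK' (hA.inter hb) (hB.inter hb) hs ht
      inter_subset_right inter_subset_right).trans (rieszE_mono κ hs' ht')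
  have hU : (⋃ n : ℕ, (A ∩ Metric.ball 0 n) ×ˢ (B ∩ Metric.ball 0 n)) = A ×ˢ B := by
    ext ⟨x, y⟩
    simp only [mem_iUnion, mem_prod, mem_inter_iff, mem_ball_zero_iff]
    constructor
    · rintro ⟨n, h1, h2⟩
      exact ⟨h1.1, h2.1⟩
    · rintro ⟨h1, h2⟩
      obtain ⟨n, hn⟩ := exists_nat_gt (max ‖x‖ ‖y‖)
      exact ⟨n, ⟨h1, (le_max_left _ _).trans_lt hn⟩, ⟨h2, (le_max_right _ _).trans_lt hn⟩⟩
  rw [rieszE, ← hU, setLIntegral_iUnion_of_directed]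
  · exact iSup_le hbd
  · refine directed_of_isDirected_le fun m n hmn => ?_
    have : Metric.ball (0 : V) m ⊆ Metric.ball 0 n :=
      Metric.ball_subset_ball (by exact_mod_cast hmn)
    exact prod_mono (inter_subset_inter_right _ this) (inter_subset_inter_right _ this)

end RieszInequality

/-! ### Equality in Riesz's inequality -/

section RieszEquality

variable {V : Type*} [NormedAddCommGroup V] [InnerProductSpace ℝ V] [FiniteDimensional ℝ V]
  [MeasurableSpace V] [BorelSpace V]

/-- A set of finite measure that is invariant under a nontrivial translation is null. -/
lemma volume_eq_zero_of_preimage_add_ae_eq {A : Set V} (hA : MeasurableSet A)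
    (hfin : volume A ≠ ⊤) {t : V} (ht : t ≠ 0) (h : (fun x => x + t) ⁻¹' A =ᵐ[volume] A) :
    volume A = 0 := by
  have hmp : ∀ s : V, MeasurePreserving (fun x : V => x + s) volume volume := fun s =>
    measurePreserving_add_right volume s
  have hn : ∀ n : ℕ, (fun x => x + (n : ℝ) • t) ⁻¹' A =ᵐ[volume] A := by
    intro n
    induction n with
    | zero =>
      simp only [Nat.cast_zero, zero_smul, add_zero]
      exact EventuallyEq.refl _ _
    | succ n ih =>
      have := (hmp ((n : ℝ) • t)).quasiMeasurePreserving.preimage_ae_eq h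
      have e : (fun x => x + ((n + 1 : ℕ) : ℝ) • t) ⁻¹' A =
          (fun x => x + (n : ℝ) • t) ⁻¹' ((fun x => x + t) ⁻¹' A) := by
        ext x
        simp only [mem_preimage, Nat.cast_add, Nat.cast_one, add_smul, one_smul, add_assoc]
      rw [e]
      exact this.trans ih
  have ht' : 0 < ‖t‖ := norm_pos_iff.2 ht
  have hR : ∀ R : ℕ, volume (A ∩ Metric.ball 0 R) = 0 := by
    intro R
    by_contra h0
    obtain ⟨N, hN⟩ := exists_nat_gt (2 * (R : ℝ) / ‖t‖)
    rw [div_lt_iff₀ ht'] at hN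
    let S : ℕ → Set V := fun n => A ∩ Metric.ball (((n * N : ℕ) : ℝ) • t) R
    have hSm : ∀ n, MeasurableSet (S n) := fun n => hA.inter Metric.isOpen_ball.measurableSet
    have hS : ∀ n, volume (S n) = volume (A ∩ Metric.ball 0 R) := by
      intro n
      rw [← (hmp (((n * N : ℕ) : ℝ) • t)).measure_preimage (hSm n).nullMeasurableSet]
      refine measure_congr ?_
      have h1 : (fun x => x + ((n * N : ℕ) : ℝ) • t) ⁻¹' S n =
          ((fun x => x + ((n * N : ℕ) : ℝ) • t) ⁻¹' A) ∩ Metric.ball 0 R := by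
        ext x
        simp [S]
      rw [h1]
      exact (hn (n * N)).inter (EventuallyEq.refl _ _)
    have hdisj : Pairwise (Function.onFun Disjoint S) := by
      intro m n hmn
      refine disjoint_left.2 fun x hx hy => ?_
      have h1 : dist x (((m * N : ℕ) : ℝ) • t) < R := hx.2
      have h2 : dist x (((n * N : ℕ) : ℝ) • t) < R := hy.2
      have h3 : dist (((m * N : ℕ) : ℝ) • t) (((n * N : ℕ) : ℝ) • t) < 2 * R := by
        refine (dist_triangle_left _ _ x).trans_lt (by linarith)
      rw [dist_eq_norm, ← sub_smul, norm_smul] at h3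
      have h4 : (N : ℝ) ≤ ‖((m * N : ℕ) : ℝ) - ((n * N : ℕ) : ℝ)‖ := by
        have h5 : (1 : ℝ) ≤ |(m : ℝ) - n| := by
          have : (1 : ℤ) ≤ |(m : ℤ) - n| := Int.one_le_abs (sub_ne_zero.2 (by exact_mod_cast hmn))
          exact_mod_cast this
        push_cast
        rw [← sub_mul, norm_mul, Real.norm_eq_abs, Real.norm_natCast]
        exact le_mul_of_one_le_left (by positivity) h5
      have h5 := mul_le_mul_of_nonneg_right h4 ht'.le
      linarith
    have hfinite := Measure.finite_const_le_meas_of_disjoint_iUnion volume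
      (pos_iff_ne_zero.2 h0) hSm hdisj
      (ne_top_of_le_ne_top hfin (measure_mono (iUnion_subset fun n => inter_subset_left)))
    refine infinite_univ (α := ℕ) (hfinite.subset fun n _ => ?_)
    exact (hS n).ge
  rw [← inter_univ A, ← Metric.iUnion_ball_nat (0 : V), inter_iUnion]
  exact measure_iUnion_null hR

lemma preimage_hypRefl_ae_eq {v : V} (hv : v ≠ 0) {B : Set V}
    (h1 : volume (goodSide v B) = 0) (h2 : volume (badSide v B) = 0) :
    hypRefl v ⁻¹' B =ᵐ[volume] B := by
  have hq := (measurePreserving_hypRefl hv).quasiMeasurePreserving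
  have a1 := measure_eq_zero_iff_ae_notMem.1 h1
  have a2 := measure_eq_zero_iff_ae_notMem.1 h2
  have a3 := hq.ae a1
  have a4 := hq.ae a2
  filter_upwards [a1, a2, a3, a4] with x b1 b2 b3 b4
  refine propext (?_ : hypRefl v x ∈ B ↔ x ∈ B)
  simp only [goodSide, badSide, mem_ofPred_eq, hypSide_hypRefl hv, hypRefl_hypRefl hv, not_and,
    not_not] at b1 b2 b3 b4
  rcases lt_trichotomy 0 (hypSide v x) with h | h | h
  · exact ⟨fun hx => by_contra fun hn => b2 h hn hx, b1 h⟩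
  · rw [hypRefl_eq_self hv h.symm]
  · have h' : 0 < -hypSide v x := by linarith
    exact ⟨b3 h', fun hx => by_contra fun hn => b4 h' hn hx⟩

/-- If `A` is polarized away from the origin, then the integrals over `A` of a function and of its
reflection differ only through the points that polarization would move. -/
lemma setLIntegral_add_badSide {v : V} (hv : v ≠ 0) {A : Set V} (hA : MeasurableSet A)
    (h : volume (goodSide v A) = 0) {w : V → ℝ≥0∞} (hw : Measurable w) :
    (∫⁻ x in A, w x) + ∫⁻ x in badSide v A, w x =
      (∫⁻ x in A, w (hypRefl v x)) + ∫⁻ x in badSide v A, w (hypRefl v x) := by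
  have hmp := measurePreserving_hypRefl hv
  have hA' : MeasurableSet (hypRefl v ⁻¹' A) := measurable_hypRefl v hA
  have hbad := measurableSet_badSide v hA
  have a1 := measure_eq_zero_iff_ae_notMem.1 h
  have a2 := hmp.quasiMeasurePreserving.ae a1
  have e1 : (A \ hypRefl v ⁻¹' A : Set V) =ᵐ[volume] hypRefl v ⁻¹' badSide v A := by
    filter_upwards [a1] with x b1
    refine propext (?_ : x ∈ A \ hypRefl v ⁻¹' A ↔ hypRefl v x ∈ badSide v A)
    simp only [goodSide, badSide, mem_ofPred_eq, hypSide_hypRefl hv, hypRefl_hypRefl hv,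
      Set.mem_sdiff, mem_preimage] at b1 ⊢
    rcases lt_trichotomy 0 (hypSide v x) with h | h | h
    · simp only [Left.neg_pos_iff, not_lt.2 h.le, false_and, iff_false]
      exact fun hx => b1 ⟨h, hx⟩
    · rw [hypRefl_eq_self hv h.symm]
      tauto
    · simp only [Left.neg_pos_iff, h, true_and]
      tauto
  have e2 : (hypRefl v ⁻¹' A \ A : Set V) =ᵐ[volume] badSide v A := by
    filter_upwards [a2] with x b1
    refine propext (?_ : x ∈ hypRefl v ⁻¹' A \ A ↔ x ∈ badSide v A)
    simp only [goodSide, badSide, mem_ofPred_eq, hypSide_hypRefl hv, hypRefl_hypRefl hv,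
      Set.mem_sdiff, mem_preimage] at b1 ⊢
    rcases lt_trichotomy 0 (hypSide v x) with h | h | h
    · simp only [h, true_and]
      tauto
    · rw [hypRefl_eq_self hv h.symm]
      tauto
    · simp only [not_lt.2 h.le, false_and, iff_false]
      exact fun hx => b1 ⟨by linarith, hx⟩
  have f1 : ∫⁻ x in hypRefl v ⁻¹' badSide v A, w x = ∫⁻ x in badSide v A, w (hypRefl v x) := by
    have := hmp.setLIntegral_comp_preimage hbad (hw.comp (measurable_hypRefl v))
    simpa only [Function.comp_apply, hypRefl_hypRefl hv] using this
  have f2 : ∫⁻ x in hypRefl v ⁻¹' A, w x = ∫⁻ x in A, w (hypRefl v x) := by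
    have := hmp.setLIntegral_comp_preimage hA (hw.comp (measurable_hypRefl v))
    simpa only [Function.comp_apply, hypRefl_hypRefl hv] using this
  rw [← f2, ← lintegral_inter_add_sdiff w A hA',
    ← lintegral_inter_add_sdiff w (hypRefl v ⁻¹' A) hA, setLIntegral_congr e1, setLIntegral_congr e2, f1, inter_comm]
  ring

/-- A strictly radially decreasing weight, used to locate the centre of a pair of sets. -/
def expWeight (x : V) : ℝ≥0∞ := ENNReal.ofReal (Real.exp (-‖x‖))

omit [InnerProductSpace ℝ V] [FiniteDimensional ℝ V] in
lemma measurable_expWeight : Measurable (expWeight : V → ℝ≥0∞) := by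
  unfold expWeight
  fun_prop

omit [InnerProductSpace ℝ V] [FiniteDimensional ℝ V] [MeasurableSpace V] [BorelSpace V] in
lemma expWeight_le_one (x : V) : expWeight x ≤ 1 := by
  simp [expWeight]

omit [InnerProductSpace ℝ V] [FiniteDimensional ℝ V] [MeasurableSpace V] [BorelSpace V] in
lemma expWeight_lt_expWeight {x y : V} (h : ‖x‖ < ‖y‖) : expWeight y < expWeight x := by
  rw [expWeight, expWeight, ENNReal.ofReal_lt_ofReal_iff (Real.exp_pos _)]
  exact Real.exp_lt_exp.2 (by linarith)

lemma exists_forall_lintegral_expWeight_le (μ : Measure V) [IsFiniteMeasure μ] [NeZero μ] :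
    ∃ c : V, ∀ c' : V, ∫⁻ x, expWeight (x - c') ∂μ ≤ ∫⁻ x, expWeight (x - c) ∂μ := by
  set F : V → ℝ := fun c => ∫ x, Real.exp (-‖x - c‖) ∂μ
  have hint : ∀ c, Integrable (fun x => Real.exp (-‖x - c‖)) μ := fun c => by
    refine Integrable.of_bound (C := 1) ?_ (ae_of_all _ fun x => ?_)
    · have : Continuous fun x : V => Real.exp (-‖x - c‖) := by fun_prop
      exact this.aestronglyMeasurable
    · rw [Real.norm_eq_abs, Real.abs_exp, Real.exp_le_one_iff]
      simp
  have hF : Continuous F := by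
    refine continuous_of_dominated (bound := fun _ => 1) (fun c => (hint c).aestronglyMeasurable)
      (fun c => ae_of_all _ fun x => ?_) (integrable_const _) (ae_of_all _ fun x => by fun_prop)
    rw [Real.norm_eq_abs, Real.abs_exp, Real.exp_le_one_iff]
    simp
  have hlim : Tendsto F (cocompact V) (𝓝 0) := by
    rw [← Metric.cobounded_eq_cocompact, ← comap_norm_atTop]
    have : (0 : ℝ) = ∫ _, (0 : ℝ) ∂μ := by simp
    rw [this]
    refine tendsto_integral_filter_of_dominated_convergence (fun _ => 1)
      (Eventually.of_forall fun c => (hint c).aestronglyMeasurable)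
      (Eventually.of_forall fun c => ae_of_all _ fun x => ?_) (integrable_const _)
      (ae_of_all _ fun x => ?_)
    · rw [Real.norm_eq_abs, Real.abs_exp, Real.exp_le_one_iff]
      simp
    · refine Real.tendsto_exp_neg_atTop_nhds_zero.comp ?_
      refine tendsto_atTop_mono (f := fun c => ‖c‖ - ‖x‖) (fun c => ?_) ?_
      · rw [norm_sub_rev]
        exact norm_sub_norm_le c x
      · exact tendsto_atTop_add_const_right _ _ tendsto_comap
  obtain ⟨c, hc⟩ := hF.exists_forall_ge' 0
    ((hlim.eventually_lt_const (integral_exp_pos (hint 0))).mono fun _ h => h.le)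
  refine ⟨c, fun c' => ?_⟩
  simp only [expWeight]
  rw [← ofReal_integral_eq_lintegral_ofReal (hint c') (ae_of_all _ fun x => (Real.exp_pos _).le),
    ← ofReal_integral_eq_lintegral_ofReal (hint c) (ae_of_all _ fun x => (Real.exp_pos _).le)]
  exact ENNReal.ofReal_le_ofReal (hc c')

/-- If the origin is the best centre for the pair `A`, `B`, and the two sets are not polarized in
opposite directions, then `A` is polarized towards the origin, unless `B` is symmetric with respect
to the hyperplane. -/
lemma volume_badSide_eq_zero_or {A B : Set V} (hA : MeasurableSet A) (hB : MeasurableSet B)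
    (hAfin : volume A ≠ ⊤) (hBfin : volume B ≠ ⊤)
    (hmax : ∀ c : V, (∫⁻ x in A, expWeight (x - c)) + ∫⁻ x in B, expWeight (x - c) ≤
      (∫⁻ x in A, expWeight x) + ∫⁻ x in B, expWeight x)
    {v : V} (hv : v ≠ 0) (h1 : volume (goodSide v A) * volume (badSide v B) = 0)
    (h2 : volume (badSide v A) * volume (goodSide v B) = 0) :
    volume (badSide v A) = 0 ∨ (volume (goodSide v B) = 0 ∧ volume (badSide v B) = 0) := by
  by_contra! hcon
  obtain ⟨hbA, hor⟩ := hcon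
  have hgB : volume (goodSide v B) = 0 := (mul_eq_zero.1 h2).resolve_left hbA
  have hgA : volume (goodSide v A) = 0 := (mul_eq_zero.1 h1).resolve_right (hor hgB)
  have eA := setLIntegral_add_badSide hv hA hgA measurable_expWeight
  have eB := setLIntegral_add_badSide hv hB hgB measurable_expWeight
  have hrefl : ∀ x : V, expWeight (x - hypRefl v 0) = expWeight (hypRefl v x) := fun x => by
    rw [expWeight, ← norm_hypRefl_sub hv, sub_zero, expWeight]
  have hm := hmax (hypRefl v 0)
  simp only [hrefl] at hm
  have hfin : ∀ (C : Set V) (w : V → ℝ≥0∞), volume C ≠ ⊤ → (∀ x, w x ≤ 1) →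
      ∫⁻ x in C, w x ≠ ⊤ := fun C w hC hw => by
    refine ne_top_of_le_ne_top hC ?_
    calc ∫⁻ x in C, w x ≤ ∫⁻ x in C, 1 := lintegral_mono hw
      _ = volume C := by simp
  have hbfin : ∀ C : Set V, MeasurableSet C → volume C ≠ ⊤ → volume (badSide v C) ≠ ⊤ :=
    fun C hCm hC => by
      refine ne_top_of_le_ne_top hC ?_
      rw [← (measurePreserving_hypRefl hv).measure_preimage hCm.nullMeasurableSet]
      exact measure_mono fun x hx => hx.2.2
  have hlt : ∀ C : Set V, ∀ x ∈ badSide v C, expWeight (hypRefl v x) < expWeight x :=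
    fun C x hx => expWeight_lt_expWeight (by
      have := norm_hypRefl_sq hv x
      have h0 : 0 < hypSide v x := hx.1
      exact (sq_lt_sq₀ (norm_nonneg _) (norm_nonneg _)).1 (by linarith))
  have sA : ∫⁻ x in badSide v A, expWeight (hypRefl v x) < ∫⁻ x in badSide v A, expWeight x :=
    setLIntegral_strict_mono (measurableSet_badSide v hA) hbA measurable_expWeight
      (hfin _ _ (hbfin A hA hAfin) fun x => expWeight_le_one _) (ae_of_all _ fun x hx => hlt A x hx)
  have sB : ∫⁻ x in badSide v B, expWeight (hypRefl v x) ≤ ∫⁻ x in badSide v B, expWeight x :=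
    setLIntegral_mono' (measurableSet_badSide v hB) fun x hx => (hlt B x hx).le
  have f1 := hfin A expWeight hAfin expWeight_le_one
  have f2 := hfin B expWeight hBfin expWeight_le_one
  have f3 := hfin _ expWeight (hbfin B hB hBfin) expWeight_le_one
  have hsum := ENNReal.add_lt_add_of_lt_of_le (ne_top_of_le_ne_top f3 sB) sA sB
  have hsum' := ENNReal.add_lt_add_of_le_of_lt
    (ne_top_of_le_ne_top (ENNReal.add_ne_top.2 ⟨f1, f2⟩) hm) hm hsum
  have heq : (∫⁻ x in A, expWeight x) + (∫⁻ x in B, expWeight x) +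
      ((∫⁻ x in badSide v A, expWeight x) + ∫⁻ x in badSide v B, expWeight x) =
      (∫⁻ x in A, expWeight (hypRefl v x)) + (∫⁻ x in B, expWeight (hypRefl v x)) +
      ((∫⁻ x in badSide v A, expWeight (hypRefl v x)) +
        ∫⁻ x in badSide v B, expWeight (hypRefl v x)) := by
    rw [add_add_add_comm, eA, eB, add_add_add_comm]
  exact (heq ▸ hsum').false

/-- If `A` and `B` are nowhere polarized in opposite directions and the origin is their best centre,
then `A` is a centred ball. For if a reflection would improve `A`, then so would the reflections in
nearby parallel hyperplanes, and `B` would be symmetric with respect to all of them, hence invariant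
under a translation. -/
lemma ae_eq_ball_of_comparable {A B : Set V} (hA : MeasurableSet A) (hB : MeasurableSet B)
    (hBfin : volume B ≠ ⊤) (hB0 : volume B ≠ 0)
    (hmax : ∀ c : V, (∫⁻ x in A, expWeight (x - c)) + ∫⁻ x in B, expWeight (x - c) ≤
      (∫⁻ x in A, expWeight x) + ∫⁻ x in B, expWeight x)
    (hcmp : ∀ v : V, v ≠ 0 → volume (goodSide v A) * volume (badSide v B) = 0 ∧
      volume (badSide v A) * volume (goodSide v B) = 0) {r : ℝ}
    (hAr : volume (Metric.ball (0 : V) r) = volume A) :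
    A =ᵐ[volume] Metric.ball 0 r := by
  have hAfin : volume A ≠ ⊤ := by rw [← hAr]; exact measure_ball_lt_top.ne
  have hbm := (Metric.isOpen_ball (x := (0 : V)) (ε := r)).measurableSet
  have hdiff := volume_diff_eq_of_volume_eq hA hbm hAr hAfin
  by_cases h0 : volume (A \ Metric.ball 0 r) = 0
  · rw [h0] at hdiff
    exact (ae_le_set.2 h0).antisymm (ae_le_set.2 hdiff)
  exfalso
  set P := Metric.ball 0 r \ A
  set Q := A \ Metric.ball 0 r
  have hPm : MeasurableSet P := hbm.diff hA
  have hQm : MeasurableSet Q := hA.diff hbm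
  obtain ⟨v, hv, hPQ⟩ := exists_volume_inter_preimage_hypRefl_ne_zero hPm hQm sdiff_subset
    (disjoint_left.2 fun x hx h => hx.2 h) (by rwa [hdiff]) h0
  have hsymm : ∀ u : V, u ≠ 0 → volume (P ∩ hypRefl u ⁻¹' Q) ≠ 0 →
      hypRefl u ⁻¹' B =ᵐ[volume] B := by
    intro u hu hne
    have hbad : volume (badSide u A) ≠ 0 := by
      refine fun h => hne (measure_mono_null ?_ h)
      rintro x ⟨⟨hx1, hx2⟩, hx3, hx4⟩
      refine ⟨?_, hx2, hx3⟩
      by_contra! hle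
      apply hx4
      rw [mem_ball_zero_iff] at hx1 ⊢
      exact (norm_hypRefl_le_norm hu hle).trans_lt hx1
    obtain ⟨h1, h2⟩ := (volume_badSide_eq_zero_or hA hB hAfin hBfin hmax hu (hcmp u hu).1
      (hcmp u hu).2).resolve_left hbad
    exact preimage_hypRefl_ae_eq hu h1 h2
  have hshift : ∀ t : ℝ, 0 < t → (1 + t / 2) • v ≠ 0 ∧
      ∀ x, hypRefl ((1 + t / 2) • v) x = hypRefl v x + t • v := by
    intro t ht
    have h1 : (1 + t / 2) ≠ 0 := by positivity
    refine ⟨smul_ne_zero h1 hv, fun x => ?_⟩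
    have h2 : ‖v‖ ^ 2 ≠ 0 := by positivity
    rw [hypRefl, hypRefl, smul_smul, add_assoc, ← add_smul, inner_smul_right, norm_smul, mul_pow,
      Real.norm_eq_abs, sq_abs]
    congr 2
    field_simp
    ring
  obtain ⟨t, ht, htPQ⟩ : ∃ t : ℝ, 0 < t ∧
      volume (P ∩ hypRefl ((1 + t / 2) • v) ⁻¹' Q) ≠ 0 := by
    let g : C(ℝ × V, V) := ⟨fun z => hypRefl v z.2 + z.1 • v, by unfold hypRefl; fun_prop⟩
    have hg : ∀ t : ℝ, MeasurePreserving (g.curry t) volume volume := fun t =>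
      (measurePreserving_add_right volume (t • v)).comp (measurePreserving_hypRefl hv)
    have hQfin : volume Q ≠ ⊤ := ne_top_of_le_ne_top hAfin (measure_mono sdiff_subset)
    have hlim := tendsto_measure_symmDiff_preimage_nhds_zero (μ := volume) (ν := volume)
      (s := Q) (g.curry.continuous.tendsto 0) (Eventually.of_forall hg) (hg 0)
      hQm.nullMeasurableSet hQfin
    have hev := (hlim.mono_left (nhdsWithin_le_nhds (s := Ioi 0))).eventually_lt_const
      (pos_iff_ne_zero.2 hPQ)
    obtain ⟨t, h1, ht⟩ := (hev.and self_mem_nhdsWithin).exists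
    refine ⟨t, ht, fun hzero => ?_⟩
    have e0 : (g.curry 0 : V → V) ⁻¹' Q = hypRefl v ⁻¹' Q := by
      ext x
      simp [g]
    have et : (g.curry t : V → V) ⁻¹' Q = hypRefl ((1 + t / 2) • v) ⁻¹' Q := by
      ext x
      simp [g, (hshift t ht).2]
    rw [e0, et] at h1
    refine (h1.trans_le ?_).false
    calc volume (P ∩ hypRefl v ⁻¹' Q)
        ≤ volume (P ∩ hypRefl ((1 + t / 2) • v) ⁻¹' Q ∪
          symmDiff (hypRefl ((1 + t / 2) • v) ⁻¹' Q) (hypRefl v ⁻¹' Q)) := by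
          refine measure_mono fun x hx => ?_
          by_cases h : x ∈ hypRefl ((1 + t / 2) • v) ⁻¹' Q
          · exact .inl ⟨hx.1, h⟩
          · exact .inr (.inr ⟨hx.2, h⟩)
      _ ≤ _ := (measure_union_le _ _).trans (by rw [hzero, zero_add])
  have hs1 := hsymm v hv hPQ
  have hs2 := hsymm _ (hshift t ht).1 htPQ
  refine hB0 (volume_eq_zero_of_preimage_add_ae_eq hB hBfin (smul_ne_zero ht.ne' hv) ?_)
  have h3 := (measurePreserving_hypRefl hv).quasiMeasurePreserving.preimage_ae_eq hs2
  have e : (fun x => x + t • v) ⁻¹' B =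
      hypRefl v ⁻¹' (hypRefl ((1 + t / 2) • v) ⁻¹' B) := by
    ext x
    simp [(hshift t ht).2, hypRefl_hypRefl hv]
  rw [e]
  exact h3.trans hs1

lemma rieszE_preimage_add {κ : ℝ → ℝ≥0∞} (hm : Measurable κ) {A B : Set V} (hA : MeasurableSet A)
    (hB : MeasurableSet B) (c : V) :
    rieszE κ ((fun x => x + c) ⁻¹' A) ((fun x => x + c) ⁻¹' B) = rieszE κ A B := by
  have hmp := (measurePreserving_add_right (volume : Measure V) c).prod
    (measurePreserving_add_right (volume : Measure V) c)
  have := hmp.setLIntegral_comp_preimage (hA.prod hB) (measurable_kernel hm)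
  simpa [Prod.map, rieszE, preimage_prod_map_prod] using this

/-- The case of equality in Riesz's rearrangement inequality (Lieb): for a strictly decreasing
kernel, two sets of positive measure must be balls with a common centre. -/
theorem ae_eq_ball_of_rieszE_eq [Nontrivial V] {κ : ℝ → ℝ≥0∞} (hm : Measurable κ)
    (hκ : StrictAntiOn κ (Ici 0)) {K : ℝ≥0∞} (hK : ∀ ρ, κ ρ ≤ K) (hK' : K ≠ ⊤)
    {A B : Set V} (hA : MeasurableSet A) (hB : MeasurableSet B) {rA rB : ℝ}
    (hrA : 0 ≤ rA) (hrB : 0 ≤ rB)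
    (hAr : volume (Metric.ball (0 : V) rA) = volume A)
    (hBr : volume (Metric.ball (0 : V) rB) = volume B) (hA0 : volume A ≠ 0) (hB0 : volume B ≠ 0)
    (heq : rieszE κ A B = rieszE κ (Metric.ball (0 : V) rA) (Metric.ball 0 rB)) :
    ∃ c : V, A =ᵐ[volume] Metric.ball c rA ∧ B =ᵐ[volume] Metric.ball c rB := by
  have hAfin : volume A ≠ ⊤ := by rw [← hAr]; exact measure_ball_lt_top.ne
  have hBfin : volume B ≠ ⊤ := by rw [← hBr]; exact measure_ball_lt_top.ne
  let μ : Measure V := volume.restrict A + volume.restrict B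
  have : IsFiniteMeasure (volume.restrict A) := ⟨by simpa using hAfin.lt_top⟩
  have : IsFiniteMeasure (volume.restrict B) := ⟨by simpa using hBfin.lt_top⟩
  have : NeZero μ := ⟨fun h => hA0 (by
    have := congrArg (fun ν : Measure V => ν univ) h
    simp only [μ, Measure.add_apply, Measure.restrict_apply_univ, Measure.coe_zero,
      Pi.zero_apply, add_eq_zero] at this
    exact this.1)⟩
  obtain ⟨c, hc⟩ := exists_forall_lintegral_expWeight_le μ
  have hmp := measurePreserving_add_right (volume : Measure V) c
  set A' := (fun x => x + c) ⁻¹' A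
  set B' := (fun x => x + c) ⁻¹' B
  have hA' : MeasurableSet A' := hmp.measurable hA
  have hB' : MeasurableSet B' := hmp.measurable hB
  have vA : volume A' = volume A := hmp.measure_preimage hA.nullMeasurableSet
  have vB : volume B' = volume B := hmp.measure_preimage hB.nullMeasurableSet
  have hint : ∀ C : Set V, MeasurableSet C → ∀ c' : V,
      ∫⁻ x in (fun x => x + c) ⁻¹' C, expWeight (x - c') =
        ∫⁻ x in C, expWeight (x - (c + c')) := by
    intro C hC c'
    have h1 : Measurable fun x : V => expWeight (x - (c + c')) :=
      measurable_expWeight.comp (measurable_id.sub_const _)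
    rw [← hmp.setLIntegral_comp_preimage hC h1]
    simp only [add_sub_add_right_eq_sub, add_comm c c']
  have hmax : ∀ c' : V, (∫⁻ x in A', expWeight (x - c')) + ∫⁻ x in B', expWeight (x - c') ≤
      (∫⁻ x in A', expWeight x) + ∫⁻ x in B', expWeight x := by
    intro c'
    have h1 := hc (c + c')
    have h2 := hint A hA 0
    have h3 := hint B hB 0
    simp only [sub_zero, add_zero] at h2 h3
    rw [h2, h3, hint A hA, hint B hB]
    simpa [μ, lintegral_add_measure] using h1
  have hE : rieszE κ A' B' = rieszE κ (Metric.ball (0 : V) rA) (Metric.ball 0 rB) :=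
    (rieszE_preimage_add hm hA hB c).trans heq
  have hEfin : rieszE κ A' B' ≠ ⊤ := ne_top_of_le_ne_top
    (ENNReal.mul_ne_top hK' (ENNReal.mul_ne_top (vA ▸ hAfin) (vB ▸ hBfin))) (rieszE_le_mul hK _ _)
  have hcmp : ∀ v : V, v ≠ 0 → volume (goodSide v A') * volume (badSide v B') = 0 ∧
      volume (badSide v A') * volume (goodSide v B') = 0 := by
    intro v hv
    refine volume_goodSide_mul_badSide hm hκ hA' hB' hv hEfin ?_
    rw [hE]
    exact rieszE_le_rieszE_ball hm hκ.antitoneOn hK hK' (measurableSet_polarize v hA')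
      (measurableSet_polarize v hB') hrA hrB (by rw [hAr, volume_polarize hv hA', vA])
      (by rw [hBr, volume_polarize hv hB', vB])
  have ha := ae_eq_ball_of_comparable hA' hB' (vB ▸ hBfin) (vB ▸ hB0) hmax hcmp (hAr.trans vA.symm)
  have hb := ae_eq_ball_of_comparable hB' hA' (vA ▸ hAfin) (vA ▸ hA0)
    (fun c' => by simpa only [add_comm] using hmax c')
    (fun v hv => by
      obtain ⟨h1, h2⟩ := hcmp v hv
      exact ⟨by rwa [mul_comm], by rwa [mul_comm]⟩) (hBr.trans vB.symm)
  have hback : ∀ (C : Set V) (r : ℝ), (fun x => x + c) ⁻¹' C =ᵐ[volume] Metric.ball 0 r →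
      C =ᵐ[volume] Metric.ball c r := by
    intro C r h
    have h1 := (measurePreserving_sub_right (volume : Measure V)
      c).quasiMeasurePreserving.preimage_ae_eq h
    have e1 : (fun x => x - c) ⁻¹' ((fun x => x + c) ⁻¹' C) = C := by
      ext x
      simp
    have e2 : (fun x => x - c) ⁻¹' Metric.ball 0 r = Metric.ball c r := by
      ext x
      simp [dist_eq_norm]
    rwa [e1, e2] at h1
  exact ⟨c, hback A rA ha, hback B rB hb⟩

end RieszEquality

/-! ### The quadratic interaction energy of two functions -/

section TwoFunctions

variable {V : Type*} [NormedAddCommGroup V] [InnerProductSpace ℝ V] [FiniteDimensional ℝ V]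
  [MeasurableSpace V] [BorelSpace V]

lemma rieszE_congr (κ : ℝ → ℝ≥0∞) {A A' B B' : Set V} (hA : A =ᵐ[volume] A')
    (hB : B =ᵐ[volume] B') : rieszE κ A B = rieszE κ A' B' :=
  setLIntegral_congr (Measure.set_prod_ae_eq hA hB)

lemma rieszE_compl_add {κ : ℝ → ℝ≥0∞} (hm : Measurable κ) {A B : Set V} (hA : MeasurableSet A)
    (hB : MeasurableSet B) :
    rieszE κ A Bᶜ + rieszE κ A B = volume A * ∫⁻ x : V, κ ‖x‖ := by
  have hk := measurable_kernel (V := V) hm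
  have hd : Disjoint (A ×ˢ Bᶜ) (A ×ˢ B) :=
    disjoint_left.2 fun z h1 h2 => h1.2 h2.2
  rw [rieszE, rieszE, ← lintegral_union (hA.prod hB) hd, ← prod_union, compl_union_self,
    ← Measure.prod_restrict, Measure.restrict_univ, lintegral_prod _ hk.aemeasurable]
  have h1 : ∀ x : V, ∫⁻ y : V, κ ‖x - y‖ = ∫⁻ y : V, κ ‖y‖ := fun x =>
    lintegral_sub_left_eq_self (fun y : V => κ ‖y‖) x
  simp only [h1, lintegral_const, Measure.restrict_apply_univ, mul_comm]

/-- The quadratic interaction energy `∬ (f(x) - g(y))² κ(|x - y|) dx dy` of two functions. -/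
def diffEnergy (κ : ℝ → ℝ≥0∞) (f g : V → ℝ) : ℝ≥0∞ :=
  ∫⁻ z, ENNReal.ofReal ((f z.1 - g z.2) ^ 2) * κ ‖z.1 - z.2‖ ∂((volume : Measure V).prod volume)

/-- Lebesgue measure on the positive levels. -/
abbrev levelMeasure : Measure ℝ := volume.restrict (Ioi 0)

lemma levelMeasure_Ico {a b : ℝ} (ha : 0 ≤ a) : levelMeasure (Ico a b) = ENNReal.ofReal (b - a) := by
  rw [Measure.restrict_apply measurableSet_Ico]
  apply le_antisymm
  · exact (measure_mono inter_subset_left).trans Real.volume_Ico.le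
  · rw [← Real.volume_Ioo]
    exact measure_mono fun x hx => ⟨Ioo_subset_Ico_self hx, ha.trans_lt hx.1⟩

/-- The square of a difference is the area of a square in the plane of pairs of levels. -/
lemma ofReal_sub_sq_eq {a b : ℝ} (ha : 0 ≤ a) (hb : 0 ≤ b) :
    ENNReal.ofReal ((a - b) ^ 2) =
      ∫⁻ p, ({p : ℝ × ℝ | max p.1 p.2 < a ∧ b ≤ min p.1 p.2}.indicator 1 p +
        {p : ℝ × ℝ | max p.1 p.2 < b ∧ a ≤ min p.1 p.2}.indicator 1 p)
        ∂(levelMeasure.prod levelMeasure) := by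
  have hset : ∀ a b : ℝ, {p : ℝ × ℝ | max p.1 p.2 < a ∧ b ≤ min p.1 p.2} =
      Ico b a ×ˢ Ico b a := fun a b => by
    ext p
    simp only [mem_ofPred_eq, max_lt_iff, le_min_iff, mem_prod, mem_Ico]
    tauto
  have hm : ∀ a b : ℝ, MeasurableSet (Ico b a ×ˢ Ico b a) := fun a b =>
    measurableSet_Ico.prod measurableSet_Ico
  simp only [hset]
  rw [lintegral_add_left (measurable_one.indicator (hm a b)), lintegral_indicator_one (hm a b),
    lintegral_indicator_one (hm b a), Measure.prod_prod, Measure.prod_prod, levelMeasure_Ico ha,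
    levelMeasure_Ico hb]
  rcases le_total a b with h | h
  · rw [ENNReal.ofReal_of_nonpos (by linarith : a - b ≤ 0), ← ENNReal.ofReal_mul (by linarith),
      zero_mul, zero_add]
    congr 1
    ring
  · rw [ENNReal.ofReal_of_nonpos (by linarith : b - a ≤ 0), ← ENNReal.ofReal_mul (by linarith),
      zero_mul, add_zero]
    congr 1
    ring

/-- The interaction energies of superlevel sets of `f` with sublevel sets of `g`, into which
`diffEnergy` decomposes. -/
def levelEnergy (κ : ℝ → ℝ≥0∞) (f g : V → ℝ) (p : ℝ × ℝ) : ℝ≥0∞ :=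
  rieszE κ {x | max p.1 p.2 < f x} {x | min p.1 p.2 < g x}ᶜ

/-- The pairs of points `x`, `y` and pairs of levels `τ`, `λ` with `g(y) ≤ τ, λ < f(x)`. -/
def levelRegion (f g : V → ℝ) : Set ((V × V) × (ℝ × ℝ)) :=
  {q | max q.2.1 q.2.2 < f q.1.1 ∧ g q.1.2 ≤ min q.2.1 q.2.2}

omit [NormedAddCommGroup V] [InnerProductSpace ℝ V] [FiniteDimensional ℝ V] [BorelSpace V] in
lemma measurableSet_levels {f g : V → ℝ} (hf : Measurable f) (hg : Measurable g) :
    MeasurableSet (levelRegion f g) := by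
  have h1 : Measurable fun q : (V × V) × (ℝ × ℝ) => f q.1.1 := by fun_prop
  have h2 : Measurable fun q : (V × V) × (ℝ × ℝ) => g q.1.2 := by fun_prop
  exact (measurableSet_lt (by fun_prop) h1).inter (measurableSet_le h2 (by fun_prop))

lemma measurable_levelIntegrand {κ : ℝ → ℝ≥0∞} (hm : Measurable κ) {f g : V → ℝ}
    (hf : Measurable f) (hg : Measurable g) :
    Measurable fun q : (V × V) × (ℝ × ℝ) =>
      (levelRegion f g).indicator 1 q * κ ‖q.1.1 - q.1.2‖ :=
  (measurable_one.indicator (measurableSet_levels hf hg)).mul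
    ((measurable_kernel hm).comp measurable_fst)

lemma lintegral_levelIntegrand {κ : ℝ → ℝ≥0∞} {f g : V → ℝ}
    (hf : Measurable f) (hg : Measurable g) (p : ℝ × ℝ) :
    ∫⁻ z, (levelRegion f g).indicator 1 (z, p) * κ ‖z.1 - z.2‖
        ∂((volume : Measure V).prod volume) = levelEnergy κ f g p := by
  have hA : MeasurableSet {x | max p.1 p.2 < f x} := measurableSet_lt measurable_const hf
  have hB : MeasurableSet {x | min p.1 p.2 < g x}ᶜ := (measurableSet_lt measurable_const hg).compl
  rw [levelEnergy, rieszE, ← lintegral_indicator (hA.prod hB)]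
  refine lintegral_congr fun z => ?_
  by_cases h : max p.1 p.2 < f z.1 ∧ g z.2 ≤ min p.1 p.2
  · have h' : z ∈ {x | max p.1 p.2 < f x} ×ˢ {x | min p.1 p.2 < g x}ᶜ :=
      ⟨h.1, not_lt.2 h.2⟩
    rw [indicator_of_mem h', indicator_of_mem (by exact h), Pi.one_apply, one_mul]
  · have h' : z ∉ {x | max p.1 p.2 < f x} ×ˢ {x | min p.1 p.2 < g x}ᶜ :=
      fun h' => h ⟨h'.1, not_lt.1 h'.2⟩
    rw [indicator_of_notMem h', indicator_of_notMem (by exact h), zero_mul]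

lemma measurable_levelEnergy {κ : ℝ → ℝ≥0∞} (hm : Measurable κ) {f g : V → ℝ}
    (hf : Measurable f) (hg : Measurable g) : Measurable (levelEnergy κ f g) := by
  have h := (measurable_levelIntegrand hm hf hg).lintegral_prod_left'
    (μ := (volume : Measure V).prod volume)
  convert h using 2 with p
  exact (lintegral_levelIntegrand hf hg p).symm

lemma levelEnergy_swap {κ : ℝ → ℝ≥0∞} (hm : Measurable κ) {f g : V → ℝ}
    (hf : Measurable f) (hg : Measurable g) (p : ℝ × ℝ) :
    ∫⁻ z, (levelRegion g f).indicator 1 (z.swap, p) * κ ‖z.1 - z.2‖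
        ∂((volume : Measure V).prod volume) = levelEnergy κ g f p := by
  have h := (Measure.measurePreserving_swap (μ := (volume : Measure V))
    (ν := (volume : Measure V))).lintegral_comp
    (f := fun z => (levelRegion g f).indicator 1 (z, p) * κ ‖z.1 - z.2‖)
    ((measurable_levelIntegrand hm hg hf).comp measurable_prodMk_right)
  rw [← lintegral_levelIntegrand hg hf p, ← h]
  simp only [Prod.fst_swap, Prod.snd_swap, norm_sub_rev]

/-- Layer-cake decomposition of the quadratic interaction energy. As only superlevel sets of positive
level occur, it does not require square integrability of `f` and `g`. -/
lemma diffEnergy_eq_lintegral_levelEnergy {κ : ℝ → ℝ≥0∞} (hm : Measurable κ) {f g : V → ℝ}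
    (hf : Measurable f) (hg : Measurable g) (hf0 : ∀ x, 0 ≤ f x) (hg0 : ∀ x, 0 ≤ g x) :
    diffEnergy κ f g = ∫⁻ p, (levelEnergy κ f g p + levelEnergy κ g f p)
      ∂(levelMeasure.prod levelMeasure) := by
  have h1 := measurable_levelIntegrand hm hf hg
  have h2 := (measurable_levelIntegrand hm hg hf).comp
    ((measurable_swap.comp measurable_fst).prodMk measurable_snd :
      Measurable fun q : (V × V) × (ℝ × ℝ) => (q.1.swap, q.2))
  have h2' : Measurable fun q : (V × V) × (ℝ × ℝ) =>
      (levelRegion g f).indicator 1 (q.1.swap, q.2) * κ ‖q.1.1 - q.1.2‖ := by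
    convert h2 using 2 with q
    simp only [Function.comp_apply, Prod.fst_swap, Prod.snd_swap, norm_sub_rev]
  have hstep : diffEnergy κ f g = ∫⁻ z, ∫⁻ p,
      ((levelRegion f g).indicator 1 (z, p) * κ ‖z.1 - z.2‖ +
      (levelRegion g f).indicator 1 (z.swap, p) * κ ‖z.1 - z.2‖)
      ∂(levelMeasure.prod levelMeasure) ∂((volume : Measure V).prod volume) := by
    refine lintegral_congr fun z => ?_
    rw [ofReal_sub_sq_eq (hf0 z.1) (hg0 z.2), ← lintegral_mul_const]
    · refine lintegral_congr fun p => ?_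
      rw [add_mul]
      rfl
    · exact ((measurable_one.indicator (measurableSet_levels hf hg)).comp
        measurable_prodMk_left).add ((measurable_one.indicator
          (measurableSet_levels hg hf)).comp (measurable_prodMk_left (x := z.swap)))
  rw [hstep, lintegral_lintegral_swap (h1.add h2').aemeasurable]
  refine lintegral_congr fun p => ?_
  have h1p : Measurable fun z : V × V =>
      (levelRegion f g).indicator 1 (z, p) * κ ‖z.1 - z.2‖ := h1.comp measurable_prodMk_right
  rw [lintegral_add_left h1p, lintegral_levelIntegrand hf hg, levelEnergy_swap hm hf hg]

/-- `F` is (a version of) the symmetric decreasing rearrangement of the nonnegative function `f`: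
up to null sets, the superlevel sets of `F` of positive level are the centred balls that have the
measures of those of `f`. In particular the latter measures are finite. -/
structure IsSymmRearr (f F : V → ℝ) : Prop where
  measurable_left : Measurable f
  measurable_right : Measurable F
  nonneg_left : ∀ x, 0 ≤ f x
  nonneg_right : ∀ x, 0 ≤ F x
  level : ∀ τ : ℝ, 0 < τ → ∃ r : ℝ, 0 ≤ r ∧
    volume (Metric.ball (0 : V) r) = volume {x | τ < f x} ∧
    {x | τ < F x} =ᵐ[volume] Metric.ball 0 r

/-- The properties of an interaction kernel that are needed for the rearrangement inequality and for
the discussion of equality. -/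
structure IsStrictKernel (V : Type*) [NormedAddCommGroup V] [InnerProductSpace ℝ V]
    [FiniteDimensional ℝ V] [MeasurableSpace V] [BorelSpace V] (κ : ℝ → ℝ≥0∞) : Prop where
  measurable : Measurable κ
  strictAntiOn : StrictAntiOn κ (Ici 0)
  bounded : ∃ K : ℝ≥0∞, K ≠ ⊤ ∧ ∀ ρ, κ ρ ≤ K
  integrable : ∫⁻ x : V, κ ‖x‖ ≠ ⊤

variable [Nontrivial V]

lemma rieszE_levels_le {κ : ℝ → ℝ≥0∞} (hκ : IsStrictKernel V κ) {f g F G : V → ℝ}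
    (hf : IsSymmRearr f F) (hg : IsSymmRearr g G) {τ s : ℝ} (hτ : 0 < τ) (hs : 0 < s) :
    rieszE κ {x | τ < f x} {x | s < g x} ≤ rieszE κ {x | τ < F x} {x | s < G x} := by
  obtain ⟨K, hK', hK⟩ := hκ.bounded
  obtain ⟨r, hr, h1, h2⟩ := hf.level τ hτ
  obtain ⟨q, hq, h3, h4⟩ := hg.level s hs
  rw [rieszE_congr κ h2 h4]
  exact rieszE_le_rieszE_ball hκ.measurable hκ.strictAntiOn.antitoneOn hK hK'
    (measurableSet_lt measurable_const hf.measurable_left)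
    (measurableSet_lt measurable_const hg.measurable_left) hr hq h1 h3

omit [Nontrivial V] in
lemma IsSymmRearr.volume_level_eq {f F : V → ℝ} (hf : IsSymmRearr f F) {τ : ℝ} (hτ : 0 < τ) :
    volume {x | τ < F x} = volume {x | τ < f x} ∧ volume {x | τ < f x} ≠ ⊤ := by
  obtain ⟨r, hr, h1, h2⟩ := hf.level τ hτ
  rw [measure_congr h2, h1]
  exact ⟨rfl, by rw [← h1]; exact measure_ball_lt_top.ne⟩

/-- Complementation turns Riesz's inequality around; all quantities are finite. -/
lemma levelEnergy_le {κ : ℝ → ℝ≥0∞} (hκ : IsStrictKernel V κ) {f g F G : V → ℝ}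
    (hf : IsSymmRearr f F) (hg : IsSymmRearr g G) {p : ℝ × ℝ} (h1 : 0 < p.1) (h2 : 0 < p.2) :
    levelEnergy κ F G p ≤ levelEnergy κ f g p ∧ levelEnergy κ F G p ≠ ⊤ ∧
      (levelEnergy κ F G p = levelEnergy κ f g p →
        rieszE κ {x | max p.1 p.2 < f x} {x | min p.1 p.2 < g x} =
          rieszE κ {x | max p.1 p.2 < F x} {x | min p.1 p.2 < G x}) := by
  have hτ : 0 < max p.1 p.2 := lt_max_of_lt_left h1
  have hs : 0 < min p.1 p.2 := lt_min h1 h2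
  have e1 := rieszE_compl_add hκ.measurable
    (measurableSet_lt (measurable_const (a := max p.1 p.2)) hf.measurable_left)
    (measurableSet_lt (measurable_const (a := min p.1 p.2)) hg.measurable_left)
  have e2 := rieszE_compl_add hκ.measurable
    (measurableSet_lt (measurable_const (a := max p.1 p.2)) hf.measurable_right)
    (measurableSet_lt (measurable_const (a := min p.1 p.2)) hg.measurable_right)
  have hle := rieszE_levels_le hκ hf hg hτ hs
  obtain ⟨hv, hfin⟩ := hf.volume_level_eq hτ
  rw [hv] at e2
  have hN : volume {x | max p.1 p.2 < f x} * ∫⁻ x : V, κ ‖x‖ ≠ ⊤ :=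
    ENNReal.mul_ne_top hfin hκ.integrable
  have hf1 := ENNReal.add_ne_top.1 (e1 ▸ hN)
  have hf2 := ENNReal.add_ne_top.1 (e2 ▸ hN)
  have e := e1.trans e2.symm
  refine ⟨?_, hf2.1, fun heq => ?_⟩
  · by_contra! hlt
    have := ENNReal.add_lt_add_of_lt_of_le hf1.2 hlt hle
    exact (e ▸ this).false
  · rw [levelEnergy, levelEnergy] at heq
    rw [heq] at e
    exact (ENNReal.add_right_inj hf1.1).1 e

lemma ae_levelMeasure_prod_pos :
    ∀ᵐ p ∂(levelMeasure.prod levelMeasure), 0 < p.1 ∧ 0 < p.2 := by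
  have h : ∀ᵐ t ∂levelMeasure, (0 : ℝ) < t := ae_restrict_mem measurableSet_Ioi
  exact (Measure.quasiMeasurePreserving_fst.ae h).and (Measure.quasiMeasurePreserving_snd.ae h)

/-- Rearranging both functions does not increase their quadratic interaction energy. -/
lemma diffEnergy_rearr_le {κ : ℝ → ℝ≥0∞} (hκ : IsStrictKernel V κ) {f g F G : V → ℝ}
    (hf : IsSymmRearr f F) (hg : IsSymmRearr g G) : diffEnergy κ F G ≤ diffEnergy κ f g := by
  rw [diffEnergy_eq_lintegral_levelEnergy hκ.measurable hf.measurable_right hg.measurable_right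
    hf.nonneg_right hg.nonneg_right, diffEnergy_eq_lintegral_levelEnergy hκ.measurable
    hf.measurable_left hg.measurable_left hf.nonneg_left hg.nonneg_left]
  refine lintegral_mono_ae ?_
  filter_upwards [ae_levelMeasure_prod_pos] with p hp
  exact add_le_add (levelEnergy_le hκ hf hg hp.1 hp.2).1 (levelEnergy_le hκ hg hf hp.1 hp.2).1

omit [Nontrivial V] in
lemma ball_center_unique {c c' : V} {r : ℝ} (h0 : volume (Metric.ball c r) ≠ 0)
    (h : Metric.ball c r =ᵐ[volume] Metric.ball c' r) : c = c' := by
  by_contra hne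
  refine h0 (volume_eq_zero_of_preimage_add_ae_eq Metric.isOpen_ball.measurableSet
    measure_ball_lt_top.ne (sub_ne_zero.2 hne) ?_)
  have e : (fun x => x + (c - c')) ⁻¹' Metric.ball c r = Metric.ball c' r := by
    ext x
    simp only [mem_preimage, Metric.mem_ball, dist_eq_norm]
    rw [show x + (c - c') - c = x - c' by abel]
  rw [e]
  exact h.symm

lemma exists_center_of_rieszE_levels_eq {κ : ℝ → ℝ≥0∞} (hκ : IsStrictKernel V κ)
    {f g F G : V → ℝ} (hf : IsSymmRearr f F) (hg : IsSymmRearr g G) {τ s : ℝ} (hτ : 0 < τ)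
    (hs : 0 < s) (hf0 : volume {x | τ < f x} ≠ 0) (hg0 : volume {x | s < g x} ≠ 0)
    (heq : rieszE κ {x | τ < f x} {x | s < g x} = rieszE κ {x | τ < F x} {x | s < G x}) :
    ∃ c : V, {x | τ < f x} =ᵐ[volume] {x | τ < F (x - c)} ∧
      {x | s < g x} =ᵐ[volume] {x | s < G (x - c)} := by
  obtain ⟨K, hK', hK⟩ := hκ.bounded
  obtain ⟨r, hr, h1, h2⟩ := hf.level τ hτ
  obtain ⟨q, hq, h3, h4⟩ := hg.level s hs
  rw [rieszE_congr κ h2 h4] at heq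
  obtain ⟨c, hc1, hc2⟩ := ae_eq_ball_of_rieszE_eq hκ.measurable hκ.strictAntiOn hK hK'
    (measurableSet_lt measurable_const hf.measurable_left)
    (measurableSet_lt measurable_const hg.measurable_left) hr hq h1 h3 hf0 hg0 heq
  have hb : ∀ (H : V → ℝ) (τ r : ℝ), {x | τ < H x} =ᵐ[volume] Metric.ball 0 r →
      Metric.ball c r =ᵐ[volume] {x | τ < H (x - c)} := by
    intro H τ r h
    have h1 := (measurePreserving_sub_right (volume : Measure V)
      c).quasiMeasurePreserving.preimage_ae_eq h
    have e2 : (fun x => x - c) ⁻¹' Metric.ball 0 r = Metric.ball c r := by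
      ext x
      simp [dist_eq_norm]
    rw [e2] at h1
    exact h1.symm
  exact ⟨c, hc1.trans (hb F τ r h2), hc2.trans (hb G s q h4)⟩

omit [Nontrivial V] in
lemma IsSymmRearr.center_unique {f F : V → ℝ} (hf : IsSymmRearr f F) {τ : ℝ} (hτ : 0 < τ)
    (h0 : volume {x | τ < f x} ≠ 0) {c c' : V}
    (h : {x | τ < F (x - c)} =ᵐ[volume] {x | τ < F (x - c')}) : c = c' := by
  obtain ⟨r, hr, h1, h2⟩ := hf.level τ hτ
  have hb : ∀ c : V, Metric.ball c r =ᵐ[volume] {x | τ < F (x - c)} := by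
    intro c
    have h1 := (measurePreserving_sub_right (volume : Measure V)
      c).quasiMeasurePreserving.preimage_ae_eq h2
    have e2 : (fun x => x - c) ⁻¹' Metric.ball 0 r = Metric.ball c r := by
      ext x
      simp [dist_eq_norm]
    rw [e2] at h1
    exact h1.symm
  refine ball_center_unique (r := r) ?_ ((hb c).trans (h.trans (hb c').symm))
  rwa [Measure.addHaar_ball_center, h1]

omit [FiniteDimensional ℝ V] [Nontrivial V] [InnerProductSpace ℝ V] [BorelSpace V]
  [NormedAddCommGroup V] in
/-- Two nonnegative functions agree if almost all of their superlevel sets do. -/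
lemma ae_eq_of_ae_level_ae_eq {μ : Measure V} [SFinite μ] {f g : V → ℝ} (hf : Measurable f)
    (hg : Measurable g) (hf0 : ∀ x, 0 ≤ f x) (hg0 : ∀ x, 0 ≤ g x)
    (h : ∀ᵐ τ ∂levelMeasure, {x | τ < f x} =ᵐ[μ] {x | τ < g x}) : f =ᵐ[μ] g := by
  have h1 : ∀ᵐ τ ∂levelMeasure, ∀ᵐ x ∂μ, (τ < f x ↔ τ < g x) := by
    filter_upwards [h] with τ hτ
    filter_upwards [hτ] with x hx
    exact Iff.of_eq hx
  have hms : MeasurableSet {q : ℝ × V | q.1 < f q.2 ↔ q.1 < g q.2} := by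
    have a1 : MeasurableSet {q : ℝ × V | q.1 < f q.2} :=
      measurableSet_lt measurable_fst (hf.comp measurable_snd)
    have a2 : MeasurableSet {q : ℝ × V | q.1 < g q.2} :=
      measurableSet_lt measurable_fst (hg.comp measurable_snd)
    exact a1.iff a2
  rw [Measure.ae_ae_comm hms] at h1
  filter_upwards [h1] with x hx
  have key : ∀ a b : ℝ, 0 ≤ a → a < b → ¬ ∀ᵐ τ ∂levelMeasure, (τ < a ↔ τ < b) := by
    intro a b ha hab hae
    have h2 : levelMeasure (Ico a b) = 0 := by
      refine measure_mono_null ?_ hae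
      intro τ hτ h3
      exact not_lt.2 hτ.1 (h3.2 hτ.2)
    rw [levelMeasure_Ico ha, ENNReal.ofReal_eq_zero] at h2
    linarith
  rcases lt_trichotomy (f x) (g x) with hlt | heq | hlt
  · exact absurd hx (key _ _ (hf0 x) hlt)
  · exact heq
  · exact absurd (hx.mono fun _ h => h.symm) (key _ _ (hg0 x) hlt)

omit [FiniteDimensional ℝ V] [Nontrivial V] [InnerProductSpace ℝ V] [BorelSpace V]
  [NormedAddCommGroup V] in
lemma exists_level_ne_zero {μ : Measure V} {f : V → ℝ} (hf0 : ∀ x, 0 ≤ f x)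
    (h : ¬ f =ᵐ[μ] 0) : ∃ τ₁ : ℝ, 0 < τ₁ ∧ ∀ τ ≤ τ₁, μ {x | τ < f x} ≠ 0 := by
  by_contra! hcon
  apply h
  have h1 : ∀ n : ℕ, μ {x | 1 / ((n : ℝ) + 1) < f x} = 0 := fun n => by
    obtain ⟨τ, hτ, h2⟩ := hcon (1 / ((n : ℝ) + 1)) (by positivity)
    exact measure_mono_null (fun x (hx : _ < f x) => (hτ.trans_lt hx : τ < f x)) h2
  have h2 := measure_iUnion_null h1
  rw [Filter.EventuallyEq, ae_iff]
  refine measure_mono_null (fun x hx => ?_) h2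
  have h3 : 0 < f x := lt_of_le_of_ne (hf0 x) (Ne.symm hx)
  obtain ⟨n, hn⟩ := exists_nat_one_div_lt h3
  exact mem_iUnion.2 ⟨n, hn⟩

lemma levelMeasure_Ioc_ne_zero {τ₁ : ℝ} (h : 0 < τ₁) : levelMeasure (Ioc 0 τ₁) ≠ 0 := by
  rw [Measure.restrict_apply measurableSet_Ioc, inter_eq_left.2 Ioc_subset_Ioi_self,
    Real.volume_Ioc]
  simpa using h

omit [Nontrivial V] in
/-- A level that is null for `f` is null for all translates of `F`. -/
lemma IsSymmRearr.level_ae_eq_of_null {f F : V → ℝ} (hf : IsSymmRearr f F) {τ : ℝ} (hτ : 0 < τ)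
    (h0 : volume {x | τ < f x} = 0) (c : V) :
    {x | τ < f x} =ᵐ[volume] {x | τ < F (x - c)} := by
  have h1 : volume {x | τ < F (x - c)} = 0 := by
    have := (measurePreserving_sub_right (volume : Measure V) c).measure_preimage
      (measurableSet_lt (measurable_const (a := τ)) hf.measurable_right).nullMeasurableSet
    rw [(hf.volume_level_eq hτ).1, h0] at this
    exact this
  exact (ae_eq_empty.2 h0).trans (ae_eq_empty.2 h1).symm

omit [Nontrivial V] in
lemma IsSymmRearr.ae_eq_of_ae_eq_zero {f F : V → ℝ} (hf : IsSymmRearr f F)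
    (h0 : f =ᵐ[volume] 0) (c : V) : f =ᵐ[volume] fun x => F (x - c) := by
  refine ae_eq_of_ae_level_ae_eq hf.measurable_left
    (hf.measurable_right.comp (measurable_id.sub_const c)) hf.nonneg_left
    (fun x => hf.nonneg_right _) ?_
  filter_upwards [ae_restrict_mem measurableSet_Ioi] with τ hτ
  refine hf.level_ae_eq_of_null hτ (measure_mono_null (fun x hx => ?_) h0) c
  exact ((mem_Ioi.1 hτ).trans hx).ne'

/-- The case of equality for two functions. -/
theorem exists_center_of_diffEnergy_eq {κ : ℝ → ℝ≥0∞} (hκ : IsStrictKernel V κ)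
    {f g F G : V → ℝ} (hf : IsSymmRearr f F) (hg : IsSymmRearr g G)
    (hfin : diffEnergy κ F G ≠ ⊤) (heq : diffEnergy κ f g = diffEnergy κ F G)
    (hf0 : ¬ f =ᵐ[volume] 0) (hg0 : ¬ g =ᵐ[volume] 0) :
    ∃ c : V, f =ᵐ[volume] (fun x => F (x - c)) ∧ g =ᵐ[volume] (fun x => G (x - c)) := by
  have hae : ∀ᵐ p ∂(levelMeasure.prod levelMeasure),
      volume {x | p.1 < f x} ≠ 0 → volume {x | p.2 < g x} ≠ 0 →
        ∃ c : V, {x | p.1 < f x} =ᵐ[volume] {x | p.1 < F (x - c)} ∧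
          {x | p.2 < g x} =ᵐ[volume] {x | p.2 < G (x - c)} := by
    rw [diffEnergy_eq_lintegral_levelEnergy hκ.measurable hf.measurable_right hg.measurable_right
      hf.nonneg_right hg.nonneg_right] at heq hfin
    rw [diffEnergy_eq_lintegral_levelEnergy hκ.measurable hf.measurable_left hg.measurable_left
      hf.nonneg_left hg.nonneg_left] at heq
    have h1 := ae_eq_of_ae_le_of_lintegral_le
      (f := fun p => levelEnergy κ F G p + levelEnergy κ G F p)
      (g := fun p => levelEnergy κ f g p + levelEnergy κ g f p)
      (μ := levelMeasure.prod levelMeasure) (by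
        filter_upwards [ae_levelMeasure_prod_pos] with p hp
        exact add_le_add (levelEnergy_le hκ hf hg hp.1 hp.2).1
          (levelEnergy_le hκ hg hf hp.1 hp.2).1) hfin
      ((measurable_levelEnergy hκ.measurable hf.measurable_left hg.measurable_left).add
        (measurable_levelEnergy hκ.measurable hg.measurable_left
          hf.measurable_left)).aemeasurable heq.le
    filter_upwards [h1, ae_levelMeasure_prod_pos] with p hp hpos hvf hvg
    obtain ⟨l1, t1, r1⟩ := levelEnergy_le hκ hf hg hpos.1 hpos.2
    obtain ⟨l2, t2, r2⟩ := levelEnergy_le hκ hg hf hpos.1 hpos.2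
    rcases le_total p.2 p.1 with h | h
    · have h3 : levelEnergy κ F G p = levelEnergy κ f g p := by
        refine le_antisymm l1 ?_
        by_contra! hlt
        exact (ENNReal.add_lt_add_of_lt_of_le t2 hlt l2).ne hp
      have h4 := r1 h3
      rw [max_eq_left h, min_eq_right h] at h4
      exact exists_center_of_rieszE_levels_eq hκ hf hg hpos.1 hpos.2 hvf hvg h4
    · have h3 : levelEnergy κ G F p = levelEnergy κ g f p := by
        refine le_antisymm l2 ?_
        by_contra! hlt
        exact (ENNReal.add_lt_add_of_le_of_lt t1 l1 hlt).ne hp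
      have h4 := r2 h3
      rw [max_eq_right h, min_eq_left h] at h4
      obtain ⟨c, hc1, hc2⟩ :=
        exists_center_of_rieszE_levels_eq hκ hg hf hpos.2 hpos.1 hvg hvf h4
      exact ⟨c, hc2, hc1⟩
  have hae1 := Measure.ae_ae_of_ae_prod hae
  have hae2 := Measure.ae_ae_of_ae_prod (Measure.measurePreserving_swap.quasiMeasurePreserving.ae
    hae : ∀ᵐ p ∂(levelMeasure.prod levelMeasure), _)
  obtain ⟨τ₁, hτ₁, hτf⟩ := exists_level_ne_zero hf.nonneg_left hf0
  obtain ⟨s₁, hs₁, hsg⟩ := exists_level_ne_zero hg.nonneg_left hg0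
  have hpick : ∀ {t : ℝ} {P : ℝ → Prop}, 0 < t → (∀ᵐ τ ∂levelMeasure, P τ) →
      ∃ τ ∈ Ioc 0 t, P τ := by
    intro t P ht hP
    by_contra! hcon
    exact levelMeasure_Ioc_ne_zero ht (measure_mono_null (fun τ hτ => hcon τ hτ) hP)
  have hpos : ∀ᵐ t ∂levelMeasure, (0 : ℝ) < t := ae_restrict_mem measurableSet_Ioi
  obtain ⟨τ₀, hτ₀, h1⟩ := hpick hτ₁ hae1
  have hvτ₀ := hτf τ₀ hτ₀.2
  obtain ⟨s₂, hs₂, h2⟩ := hpick hs₁ h1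
  obtain ⟨c, hcf, -⟩ := h2 hvτ₀ (hsg s₂ hs₂.2)
  have hlevel_g : ∀ᵐ s ∂levelMeasure, {x | s < g x} =ᵐ[volume] {x | s < G (x - c)} := by
    filter_upwards [h1, hpos] with s hs hs0
    by_cases hv : volume {x | s < g x} = 0
    · exact hg.level_ae_eq_of_null hs0 hv c
    · obtain ⟨c', h3, h4⟩ := hs hvτ₀ hv
      rwa [hf.center_unique hτ₀.1 hvτ₀ (hcf.symm.trans h3)]
  obtain ⟨s₀, hs₀, h3, h4⟩ := hpick hs₁ (hae2.and hlevel_g)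
  have hvs₀ := hsg s₀ hs₀.2
  have hlevel_f : ∀ᵐ τ ∂levelMeasure, {x | τ < f x} =ᵐ[volume] {x | τ < F (x - c)} := by
    filter_upwards [h3, hpos] with τ hτ hτ0
    by_cases hv : volume {x | τ < f x} = 0
    · exact hf.level_ae_eq_of_null hτ0 hv c
    · obtain ⟨c', h5, h6⟩ := hτ hv hvs₀
      rwa [hg.center_unique hs₀.1 hvs₀ (h4.symm.trans h6)]
  exact ⟨c, ae_eq_of_ae_level_ae_eq hf.measurable_left
      (hf.measurable_right.comp (measurable_id.sub_const c)) hf.nonneg_left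
      (fun x => hf.nonneg_right _) hlevel_f,
    ae_eq_of_ae_level_ae_eq hg.measurable_left
      (hg.measurable_right.comp (measurable_id.sub_const c)) hg.nonneg_left
      (fun x => hg.nonneg_right _) hlevel_g⟩

end TwoFunctions

/-! ### The slicewise rearrangement -/

section Rearrangement

variable {d : ℕ}

lemma symmDecrRearr_eq_volume (f : EuclideanSpace ℝ (Fin d) → ℝ) (x : EuclideanSpace ℝ (Fin d)) :
    symmDecrRearr f x = ∫⁻ t in Ioi (0 : ℝ),
      {t : ℝ | volume (Metric.ball (0 : EuclideanSpace ℝ (Fin d)) ‖x‖) <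
        volume {y | t < |f y|}}.indicator 1 t := rfl

lemma antitone_volume_level {α : Type*} [MeasurableSpace α] (μ : Measure α) (f : α → ℝ) :
    Antitone fun t : ℝ => μ {y | t < |f y|} := fun _ _ h =>
  measure_mono fun _ (hy : _ < _) => h.trans_lt hy

lemma exists_gt_lt_volume_level {α : Type*} [MeasurableSpace α] (μ : Measure α) (f : α → ℝ)
    {b : ℝ≥0∞} {s : ℝ} (h : b < μ {y | s < |f y|}) : ∃ s' > s, b < μ {y | s' < |f y|} := by
  have hU : {y | s < |f y|} = ⋃ k : ℕ, {y | s + 1 / ((k : ℝ) + 1) < |f y|} := by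
    ext y
    simp only [mem_ofPred_eq, mem_iUnion]
    constructor
    · intro hy
      obtain ⟨k, hk⟩ := exists_nat_one_div_lt (sub_pos.2 hy)
      exact ⟨k, by linarith⟩
    · rintro ⟨k, hk⟩
      have : (0 : ℝ) < 1 / ((k : ℝ) + 1) := by positivity
      linarith
  have hmono : Monotone fun k : ℕ => {y | s + 1 / ((k : ℝ) + 1) < |f y|} := by
    intro k l hkl y hy
    have hy' : s + 1 / ((k : ℝ) + 1) < |f y| := hy
    have : 1 / ((l : ℝ) + 1) ≤ 1 / ((k : ℝ) + 1) := by gcongr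
    exact (by linarith : s + 1 / ((l : ℝ) + 1) < |f y|)
  rw [hU] at h
  obtain ⟨k, hk⟩ := ((tendsto_measure_iUnion_atTop (μ := μ) hmono).eventually_const_lt h).exists
  exact ⟨s + 1 / ((k : ℝ) + 1), by
    have : (0 : ℝ) < 1 / ((k : ℝ) + 1) := by positivity
    linarith, hk⟩

lemma exists_volume_level_le {α : Type*} [MeasurableSpace α] {μ : Measure α} {f : α → ℝ}
    (hf : Measurable f) (hfin : ∀ s : ℝ, 0 < s → μ {y | s < |f y|} < ⊤) {b : ℝ≥0∞} (hb : 0 < b) :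
    ∃ t : ℝ, 0 < t ∧ μ {y | t < |f y|} ≤ b := by
  have hI : (⋂ k : ℕ, {y | (k : ℝ) + 1 < |f y|}) = ∅ := by
    refine eq_empty_of_forall_notMem fun y hy => ?_
    obtain ⟨k, hk⟩ := exists_nat_gt |f y|
    have : (k : ℝ) + 1 < |f y| := mem_iInter.1 hy k
    linarith
  have ht := tendsto_measure_iInter_atTop (μ := μ) (s := fun k : ℕ => {y | (k : ℝ) + 1 < |f y|})
    (fun k => (measurableSet_lt measurable_const hf.abs).nullMeasurableSet)
    (by
      intro k l hkl y hy
      have hy' : (l : ℝ) + 1 < |f y| := hy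
      have : (k : ℝ) ≤ l := by exact_mod_cast hkl
      exact (by linarith : (k : ℝ) + 1 < |f y|))
    ⟨0, (hfin _ (by positivity)).ne⟩
  rw [hI, measure_empty] at ht
  obtain ⟨k, hk⟩ := (ht.eventually_lt_const hb).exists
  exact ⟨(k : ℝ) + 1, by positivity, hk.le⟩

/-- Away from the origin, the superlevel sets of the symmetric decreasing rearrangement are the
rearrangements of those of the function. -/
lemma lt_symmDecrRearr_iff [Nontrivial (EuclideanSpace ℝ (Fin d))]
    {f : EuclideanSpace ℝ (Fin d) → ℝ} (hf : Measurable f)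
    (hfin : ∀ s : ℝ, 0 < s → volume {y | s < |f y|} < ⊤) {x : EuclideanSpace ℝ (Fin d)}
    (hx : x ≠ 0) {s : ℝ} (hs : 0 < s) :
    s < (symmDecrRearr f x).toReal ↔
      volume (Metric.ball (0 : EuclideanSpace ℝ (Fin d)) ‖x‖) < volume {y | s < |f y|} := by
  set b := volume (Metric.ball (0 : EuclideanSpace ℝ (Fin d)) ‖x‖)
  have hb : 0 < b := Metric.measure_ball_pos _ _ (norm_pos_iff.2 hx)
  set T : Set ℝ := {t : ℝ | b < volume {y | t < |f y|}}
  have hanti := antitone_volume_level (volume : Measure (EuclideanSpace ℝ (Fin d))) f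
  have hTm : MeasurableSet T := measurableSet_lt measurable_const hanti.measurable
  have hvol : symmDecrRearr f x = volume (T ∩ Ioi 0) := by
    rw [symmDecrRearr_eq_volume, lintegral_indicator_one hTm, Measure.restrict_apply hTm]
  have hup : ∀ t : ℝ, volume {y | t < |f y|} ≤ b → volume (T ∩ Ioi 0) ≤ ENNReal.ofReal t := by
    intro t ht
    have : T ∩ Ioi 0 ⊆ Ioo 0 t := fun r hr => ⟨hr.2, by
      by_contra! hle
      exact (((hanti hle).trans ht).trans_lt hr.1).false⟩
    simpa using measure_mono (μ := volume) this
  have hlt : symmDecrRearr f x < ⊤ := by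
    obtain ⟨t, -, ht⟩ := exists_volume_level_le hf hfin hb
    rw [hvol]
    exact (hup t ht).trans_lt ENNReal.ofReal_lt_top
  rw [← ENNReal.ofReal_lt_iff_lt_toReal hs.le hlt.ne, hvol]
  constructor
  · intro h
    by_contra! hle
    exact (h.trans_le (hup s hle)).false
  · intro h
    obtain ⟨s', hs', h'⟩ := exists_gt_lt_volume_level _ f h
    have hsub : Ioc 0 s' ⊆ T ∩ Ioi 0 := fun r hr => ⟨h'.trans_le (hanti hr.2), hr.1⟩
    calc ENNReal.ofReal s < ENNReal.ofReal s' :=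
          (ENNReal.ofReal_lt_ofReal_iff (hs.trans hs')).2 hs'
      _ = volume (Ioc 0 s') := by simp
      _ ≤ _ := measure_mono hsub

lemma symmDecrRearr_congr {f g : EuclideanSpace ℝ (Fin d) → ℝ}
    (h : ∀ t : ℝ, volume {y | t < |f y|} = volume {y | t < |g y|}) :
    symmDecrRearr f = symmDecrRearr g := by
  funext x
  simp only [symmDecrRearr_eq_volume, h]

lemma measurable_sliceRearr {n : ℕ} {u : SplitSpace n → ℝ} (hu : Measurable u) :
    Measurable (sliceRearr u) := by
  have h1 : Measurable fun q : SplitSpace n × ℝ =>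
      volume {y : HorizSpace n | q.2 < |u (y, q.1.2)|} := by
    have hs : MeasurableSet {p : (SplitSpace n × ℝ) × HorizSpace n |
        p.1.2 < |u (p.2, p.1.1.2)|} := by
      refine measurableSet_lt (by fun_prop) ?_
      exact (hu.comp (by fun_prop : Measurable fun p : (SplitSpace n × ℝ) × HorizSpace n =>
        ((p.2, p.1.1.2) : SplitSpace n))).abs
    exact measurable_measure_prodMk_left hs
  have h2 : Measurable fun q : SplitSpace n × ℝ =>
      volume (Metric.ball (0 : HorizSpace n) ‖q.1.1‖) := by
    have hm : Monotone fun r : ℝ => volume (Metric.ball (0 : HorizSpace n) r) := fun r s h =>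
      measure_mono (Metric.ball_subset_ball h)
    exact hm.measurable.comp (by fun_prop : Measurable fun q : SplitSpace n × ℝ => ‖q.1.1‖)
  have h3 : Measurable fun q : SplitSpace n × ℝ =>
      {q : SplitSpace n × ℝ | volume (Metric.ball (0 : HorizSpace n) ‖q.1.1‖) <
        volume {y : HorizSpace n | q.2 < |u (y, q.1.2)|}}.indicator (1 : SplitSpace n × ℝ → ℝ≥0∞) q :=
    measurable_one.indicator (measurableSet_lt h2 h1)
  exact (h3.lintegral_prod_right' (ν := volume.restrict (Ioi 0))).ennreal_toReal

lemma isSymmRearr_slice {n : ℕ} [Nontrivial (HorizSpace n)] {u : SplitSpace n → ℝ}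
    (hu : Measurable u) {t : ℝ}
    (hfin : ∀ s : ℝ, 0 < s → volume {x' : HorizSpace n | s < |u (x', t)|} < ⊤) :
    IsSymmRearr (fun x' => |u (x', t)|) (fun x' => sliceRearr u (x', t)) where
  measurable_left := (hu.comp measurable_prodMk_right).abs
  measurable_right := (measurable_sliceRearr hu).comp measurable_prodMk_right
  nonneg_left _ := abs_nonneg _
  nonneg_right _ := ENNReal.toReal_nonneg
  level τ hτ := by
    obtain ⟨r, hr, h⟩ := exists_volume_ball_eq (V := HorizSpace n) (hfin τ hτ).ne
    refine ⟨r, hr, h, ?_⟩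
    have h0 : ∀ᵐ x : HorizSpace n, x ≠ 0 := by
      simp [ae_iff]
    filter_upwards [h0] with x hx
    refine propext (?_ : τ < sliceRearr u (x, t) ↔ x ∈ Metric.ball 0 r)
    have hm : Measurable fun x' : HorizSpace n => u (x', t) := hu.comp measurable_prodMk_right
    rw [sliceRearr, lt_symmDecrRearr_iff hm hfin hx hτ, ← h,
      volume_ball_lt_iff (norm_nonneg x) hr, mem_ball_zero_iff]

end Rearrangement

/-! ### The interaction kernel of two slices -/

section Kernel

/-- The kernel `(ρ² + h²)^{-(n+2σ)/2}` through which the horizontal slices at height difference `h`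
interact. -/
def sliceKernel (n : ℕ) (σ h ρ : ℝ) : ℝ≥0∞ :=
  ENNReal.ofReal (1 / Real.sqrt (ρ ^ 2 + h ^ 2) ^ ((n : ℝ) + 2 * σ))

lemma measurable_sliceKernel (n : ℕ) (σ h : ℝ) : Measurable (sliceKernel n σ h) := by
  unfold sliceKernel
  fun_prop

lemma strictAntiOn_sliceKernel (n : ℕ) {σ h : ℝ} (hσ : 0 < σ) (hh : h ≠ 0) :
    StrictAntiOn (sliceKernel n σ h) (Ici 0) := by
  intro a ha b hb hab
  have ha' : (0 : ℝ) ≤ a := ha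
  have h1 : 0 < Real.sqrt (a ^ 2 + h ^ 2) := Real.sqrt_pos.2 (by positivity)
  have h2 : Real.sqrt (a ^ 2 + h ^ 2) < Real.sqrt (b ^ 2 + h ^ 2) :=
    Real.sqrt_lt_sqrt (by positivity) (by gcongr)
  rw [sliceKernel, sliceKernel, ENNReal.ofReal_lt_ofReal_iff (by positivity)]
  exact one_div_lt_one_div_of_lt (by positivity) (Real.rpow_lt_rpow h1.le h2 (by positivity))

lemma exists_sliceKernel_le (n : ℕ) {σ h : ℝ} (hσ : 0 < σ) (hh : h ≠ 0) :
    ∃ K : ℝ≥0∞, K ≠ ⊤ ∧ ∀ ρ, sliceKernel n σ h ρ ≤ K := by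
  refine ⟨ENNReal.ofReal (1 / |h| ^ ((n : ℝ) + 2 * σ)), ENNReal.ofReal_ne_top, fun ρ => ?_⟩
  have h1 : 0 < |h| := abs_pos.2 hh
  have h2 : |h| ≤ Real.sqrt (ρ ^ 2 + h ^ 2) := by
    rw [← Real.sqrt_sq_eq_abs]
    exact Real.sqrt_le_sqrt (by nlinarith [sq_nonneg ρ])
  unfold sliceKernel
  gcongr

lemma lintegral_sliceKernel_ne_top {n : ℕ} (hn : 1 ≤ n) {σ : ℝ} (hσ : 0 < σ) {h : ℝ}
    (hh : h ≠ 0) : ∫⁻ x : HorizSpace n, sliceKernel n σ h ‖x‖ ≠ ⊤ := by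
  have hd : ((Module.finrank ℝ (HorizSpace n) : ℕ) : ℝ) < (n : ℝ) + 2 * σ := by
    rw [finrank_euclideanSpace, Fintype.card_fin, Nat.cast_sub hn]
    push_cast
    linarith
  have hint := (integrable_rpow_neg_one_add_norm_sq (E := HorizSpace n) (μ := volume) hd)
  set c : ℝ := min 1 |h|
  have hc : 0 < c := lt_min one_pos (abs_pos.2 hh)
  have hp : 0 < (n : ℝ) + 2 * σ := by positivity
  have hle : ∀ x : HorizSpace n, 1 / Real.sqrt (‖x‖ ^ 2 + h ^ 2) ^ ((n : ℝ) + 2 * σ) ≤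
      1 / c ^ ((n : ℝ) + 2 * σ) * (1 + ‖x‖ ^ 2) ^ (-((n : ℝ) + 2 * σ) / 2) := by
    intro x
    have h1 : c * Real.sqrt (1 + ‖x‖ ^ 2) ≤ Real.sqrt (‖x‖ ^ 2 + h ^ 2) := by
      apply Real.le_sqrt_of_sq_le
      rw [mul_pow, Real.sq_sqrt (by positivity)]
      have e1 : c ^ 2 ≤ 1 := by
        have := min_le_left 1 |h|
        exact pow_le_one₀ hc.le this
      have e2 : c ^ 2 ≤ h ^ 2 := by
        rw [← sq_abs h]
        exact pow_le_pow_left₀ hc.le (min_le_right _ _) 2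
      nlinarith [sq_nonneg ‖x‖]
    have h2 : (1 + ‖x‖ ^ 2) ^ (-((n : ℝ) + 2 * σ) / 2) =
        1 / Real.sqrt (1 + ‖x‖ ^ 2) ^ ((n : ℝ) + 2 * σ) := by
      rw [Real.sqrt_eq_rpow, ← Real.rpow_mul (by positivity), neg_div,
        Real.rpow_neg (by positivity), one_div]
      congr 2
      ring
    have h3 : 0 < Real.sqrt (1 + ‖x‖ ^ 2) := Real.sqrt_pos.2 (by positivity)
    rw [h2, one_div_mul_one_div, ← Real.mul_rpow hc.le h3.le]
    gcongr
  refine ((lintegral_mono fun x => ENNReal.ofReal_le_ofReal (hle x)).trans_lt ?_).ne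
  exact (hint.const_mul _).lintegral_lt_top

/-- For a nonzero height difference the kernel is bounded and integrable over the horizontal space,
so that no singularity is left. -/
lemma isStrictKernel_sliceKernel {n : ℕ} (hn : 1 ≤ n) {σ : ℝ} (hσ : 0 < σ) {h : ℝ} (hh : h ≠ 0) :
    IsStrictKernel (HorizSpace n) (sliceKernel n σ h) where
  measurable := measurable_sliceKernel n σ h
  strictAntiOn := strictAntiOn_sliceKernel n hσ hh
  bounded := exists_sliceKernel_le n hσ hh
  integrable := lintegral_sliceKernel_ne_top hn hσ hh

end Kernel

/-! ### Slicing the regional energy -/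

section Slicing

/-- Lebesgue measure on the upper half space. -/
abbrev halfMeasure (n : ℕ) : Measure (SplitSpace n) := volume.restrict (upperHalf n)

lemma halfMeasure_eq_prod (n : ℕ) :
    halfMeasure n = (volume : Measure (HorizSpace n)).prod (volume.restrict (Ioi 0)) := by
  have : upperHalf n = univ ×ˢ Ioi 0 := by
    ext x
    simp [upperHalf]
  rw [halfMeasure, this, Measure.volume_eq_prod, ← Measure.prod_restrict, Measure.restrict_univ]

/-- The integrand of the regional energy. -/
def energyIntegrand (n : ℕ) (σ : ℝ) (w : SplitSpace n → ℝ) (x y : SplitSpace n) : ℝ≥0∞ :=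
  ENNReal.ofReal ((w x - w y) ^ 2 / euclDist x y ^ ((n : ℝ) + 2 * σ))

lemma energyIntegrand_eq (n : ℕ) (σ : ℝ) (w : SplitSpace n → ℝ) (x y : SplitSpace n) :
    energyIntegrand n σ w x y = ENNReal.ofReal ((w x - w y) ^ 2) *
      sliceKernel n σ (x.2 - y.2) ‖x.1 - y.1‖ := by
  rw [energyIntegrand, sliceKernel, euclDist, ← ENNReal.ofReal_mul (sq_nonneg _), mul_one_div]

lemma measurable_energyIntegrand (n : ℕ) (σ : ℝ) {w : SplitSpace n → ℝ} (hw : Measurable w) :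
    Measurable fun q : SplitSpace n × SplitSpace n => energyIntegrand n σ w q.1 q.2 := by
  unfold energyIntegrand euclDist
  fun_prop

lemma regionalEnergy_eq_prod (n : ℕ) (σ : ℝ) {w : SplitSpace n → ℝ} (hw : Measurable w) :
    regionalEnergy n σ (upperHalf n) w =
      ∫⁻ q, energyIntegrand n σ w q.1 q.2 ∂((halfMeasure n).prod (halfMeasure n)) := by
  rw [lintegral_prod _ (measurable_energyIntegrand n σ hw).aemeasurable]
  rfl

/-- The interaction energy of the horizontal slices of `w` at two heights. -/
def sliceEnergy (n : ℕ) (σ : ℝ) (w : SplitSpace n → ℝ) (q : ℝ × ℝ) : ℝ≥0∞ :=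
  diffEnergy (sliceKernel n σ (q.1 - q.2)) (fun x' : HorizSpace n => w (x', q.1))
    (fun y' : HorizSpace n => w (y', q.2))

lemma sliceEnergy_eq (n : ℕ) (σ : ℝ) (w : SplitSpace n → ℝ) (q : ℝ × ℝ) :
    sliceEnergy n σ w q = ∫⁻ z : HorizSpace n × HorizSpace n,
      energyIntegrand n σ w (z.1, q.1) (z.2, q.2)
        ∂((volume : Measure (HorizSpace n)).prod volume) := by
  rw [sliceEnergy, diffEnergy]
  simp only [energyIntegrand_eq]

lemma measurable_sliceEnergy (n : ℕ) (σ : ℝ) {w : SplitSpace n → ℝ} (hw : Measurable w) :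
    Measurable (sliceEnergy n σ w) := by
  have h1 : Measurable fun p : (ℝ × ℝ) × (HorizSpace n × HorizSpace n) =>
      energyIntegrand n σ w (p.2.1, p.1.1) (p.2.2, p.1.2) := by
    have h0 : Measurable fun p : (ℝ × ℝ) × (HorizSpace n × HorizSpace n) =>
        (((p.2.1, p.1.1), (p.2.2, p.1.2)) : SplitSpace n × SplitSpace n) :=
      ((measurable_fst.comp measurable_snd).prodMk (measurable_fst.comp measurable_fst)).prodMk
        ((measurable_snd.comp measurable_snd).prodMk (measurable_snd.comp measurable_fst))
    have h := (measurable_energyIntegrand n σ hw).comp h0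
    exact h
  rw [funext (sliceEnergy_eq n σ w)]
  exact h1.lintegral_prod_right'

/-- The regional energy is the superposition of the interaction energies of horizontal slices. -/
lemma regionalEnergy_eq_lintegral_sliceEnergy (n : ℕ) (σ : ℝ) {w : SplitSpace n → ℝ}
    (hw : Measurable w) :
    regionalEnergy n σ (upperHalf n) w =
      ∫⁻ q, sliceEnergy n σ w q ∂(levelMeasure.prod levelMeasure) := by
  have hm := measurable_energyIntegrand n σ hw
  have h1 : regionalEnergy n σ (upperHalf n) w =
      ∫⁻ x, ∫⁻ y, energyIntegrand n σ w x y ∂(halfMeasure n) ∂(halfMeasure n) := rfl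
  have hin : Measurable fun x => ∫⁻ y, energyIntegrand n σ w x y ∂(halfMeasure n) :=
    hm.lintegral_prod_right'
  rw [h1, lintegral_prod _ (measurable_sliceEnergy n σ hw).aemeasurable]
  nth_rewrite 2 [halfMeasure_eq_prod]
  rw [halfMeasure_eq_prod] at hin
  simp only [halfMeasure_eq_prod]
  rw [lintegral_prod_symm _ hin.aemeasurable]
  refine lintegral_congr fun s => ?_
  have h2 : ∀ x' : HorizSpace n, ∫⁻ y, energyIntegrand n σ w (x', s) y
      ∂((volume : Measure (HorizSpace n)).prod (volume.restrict (Ioi 0))) =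
      ∫⁻ t in Ioi (0 : ℝ), ∫⁻ y' : HorizSpace n, energyIntegrand n σ w (x', s) (y', t) := by
    intro x'
    have h := hm.comp (measurable_prodMk_left (x := ((x', s) : SplitSpace n)))
    have h' : Measurable fun y => energyIntegrand n σ w (x', s) y := h
    exact lintegral_prod_symm _ h'.aemeasurable
  simp only [h2]
  have h3 : Measurable fun p : (HorizSpace n × ℝ) × HorizSpace n =>
      energyIntegrand n σ w (p.1.1, s) (p.2, p.1.2) := by
    have h0 : Measurable fun p : (HorizSpace n × ℝ) × HorizSpace n =>
        (((p.1.1, s), (p.2, p.1.2)) : SplitSpace n × SplitSpace n) :=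
      ((measurable_fst.comp measurable_fst).prodMk measurable_const).prodMk
        (measurable_snd.prodMk (measurable_snd.comp measurable_fst))
    have h := hm.comp h0
    exact h
  rw [lintegral_lintegral_swap h3.lintegral_prod_right'.aemeasurable]
  refine lintegral_congr fun t => ?_
  have h4 : Measurable fun z : HorizSpace n × HorizSpace n =>
      energyIntegrand n σ w (z.1, s) (z.2, t) := by
    have h0 : Measurable fun z : HorizSpace n × HorizSpace n =>
        (((z.1, s), (z.2, t)) : SplitSpace n × SplitSpace n) :=
      (measurable_fst.prodMk measurable_const).prodMk (measurable_snd.prodMk measurable_const)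
    have h := hm.comp h0
    exact h
  rw [← lintegral_prod _ h4.aemeasurable, sliceEnergy_eq]

end Slicing

/-! ### Rearrangement on the half space -/

section HalfSpace

variable {n : ℕ} {σ : ℝ}

lemma nontrivial_horizSpace (hn : 2 ≤ n) : Nontrivial (HorizSpace n) := by
  have : Nonempty (Fin (n - 1)) := ⟨⟨0, by omega⟩⟩
  infer_instance

lemma ae_fst_ne_snd_levelMeasure : ∀ᵐ q ∂(levelMeasure.prod levelMeasure), q.1 ≠ q.2 := by
  have hms : MeasurableSet {q : ℝ × ℝ | q.1 ≠ q.2} :=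
    (measurableSet_eq_fun measurable_fst measurable_snd).compl
  rw [Measure.ae_prod_iff_ae_ae hms]
  refine ae_of_all _ fun s => ?_
  have h : ∀ᵐ t ∂(volume : Measure ℝ), t ≠ s := by simp [ae_iff]
  exact (ae_restrict_of_ae h).mono fun t ht => ht.symm

lemma energyIntegrand_abs_le (n : ℕ) (σ : ℝ) (u : SplitSpace n → ℝ) (x y : SplitSpace n) :
    energyIntegrand n σ (fun z => |u z|) x y ≤ energyIntegrand n σ u x y := by
  unfold energyIntegrand euclDist
  have : (|u x| - |u y|) ^ 2 ≤ (u x - u y) ^ 2 := sq_le_sq.2 (abs_abs_sub_abs_le _ _)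
  gcongr

lemma mul_nonneg_of_energyIntegrand_abs_eq {u : SplitSpace n → ℝ} {x y : SplitSpace n}
    (h : energyIntegrand n σ (fun z => |u z|) x y = energyIntegrand n σ u x y) :
    0 ≤ u x * u y := by
  by_cases hxy : x = y
  · rw [hxy]
    exact mul_self_nonneg _
  have hd : 0 < euclDist x y := by
    refine Real.sqrt_pos.2 ?_
    by_contra! hle
    apply hxy
    have h1 : ‖x.1 - y.1‖ ^ 2 = 0 := by nlinarith [sq_nonneg ‖x.1 - y.1‖, sq_nonneg (x.2 - y.2)]
    have h2 : (x.2 - y.2) ^ 2 = 0 := by nlinarith [sq_nonneg ‖x.1 - y.1‖, sq_nonneg (x.2 - y.2)]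
    refine Prod.ext ?_ ?_
    · exact sub_eq_zero.1 (norm_eq_zero.1 (pow_eq_zero_iff two_ne_zero |>.1 h1))
    · exact sub_eq_zero.1 (pow_eq_zero_iff two_ne_zero |>.1 h2)
  have hp : 0 < euclDist x y ^ ((n : ℝ) + 2 * σ) := Real.rpow_pos_of_pos hd _
  rw [energyIntegrand, energyIntegrand, ENNReal.ofReal_eq_ofReal_iff (by positivity)
    (by positivity), div_left_inj' hp.ne'] at h
  have h1 : |u x| * |u y| = u x * u y := by nlinarith [sq_abs (u x), sq_abs (u y)]
  rw [← h1]
  positivity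

lemma regionalEnergy_abs_le (n : ℕ) (σ : ℝ) (u : SplitSpace n → ℝ) :
    regionalEnergy n σ (upperHalf n) (fun x => |u x|) ≤ regionalEnergy n σ (upperHalf n) u :=
  lintegral_mono fun x => lintegral_mono fun y => energyIntegrand_abs_le n σ u x y

/-- A function whose energy is not decreased by taking absolute values has a sign. -/
lemma ae_abs_eq_or_of_regionalEnergy_eq {u : SplitSpace n → ℝ} (hu : Measurable u)
    (hfin : regionalEnergy n σ (upperHalf n) u ≠ ⊤)
    (heq : regionalEnergy n σ (upperHalf n) u = regionalEnergy n σ (upperHalf n) fun x => |u x|) :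
    (∀ᵐ x ∂(halfMeasure n), u x = |u x|) ∨ (∀ᵐ x ∂(halfMeasure n), u x = -|u x|) := by
  have hu' : Measurable fun x => |u x| := hu.abs
  rw [regionalEnergy_eq_prod n σ hu'] at heq
  rw [heq] at hfin
  rw [regionalEnergy_eq_prod n σ hu] at heq
  have h1 := ae_eq_of_ae_le_of_lintegral_le
    (ae_of_all _ fun q : SplitSpace n × SplitSpace n => energyIntegrand_abs_le n σ u q.1 q.2)
    hfin (measurable_energyIntegrand n σ hu).aemeasurable heq.le
  have h2 : ∀ᵐ q ∂((halfMeasure n).prod (halfMeasure n)), 0 ≤ u q.1 * u q.2 :=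
    h1.mono fun q hq => mul_nonneg_of_energyIntegrand_abs_eq hq
  have h3 := Measure.ae_ae_of_ae_prod h2
  by_cases hneg : ∀ᵐ x ∂(halfMeasure n), u x ≤ 0
  · right
    exact hneg.mono fun x hx => by rw [abs_of_nonpos hx, neg_neg]
  · left
    have hfreq : ∃ᵐ x ∂(halfMeasure n), 0 < u x := by
      rw [Filter.Frequently]
      simpa only [not_lt] using hneg
    obtain ⟨x, hx0, hx⟩ := (hfreq.and_eventually h3).exists
    exact hx.mono fun y hy => (abs_of_nonneg (nonneg_of_mul_nonneg_right hy hx0)).symm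

variable {u : SplitSpace n → ℝ}

lemma sliceEnergy_rearr_le (hn : 2 ≤ n) (hσ : 0 < σ) (hu : Measurable u)
    (hfin : ∀ t s : ℝ, 0 < s → volume {x' : HorizSpace n | s < |u (x', t)|} < ⊤)
    {q : ℝ × ℝ} (hq : q.1 ≠ q.2) :
    sliceEnergy n σ (sliceRearr u) q ≤ sliceEnergy n σ (fun x => |u x|) q := by
  have := nontrivial_horizSpace hn
  exact diffEnergy_rearr_le (isStrictKernel_sliceKernel (by omega) hσ (sub_ne_zero.2 hq))
    (isSymmRearr_slice hu (hfin q.1)) (isSymmRearr_slice hu (hfin q.2))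

lemma regionalEnergy_sliceRearr_le (hn : 2 ≤ n) (hσ : 0 < σ) (hu : Measurable u)
    (hfin : ∀ t s : ℝ, 0 < s → volume {x' : HorizSpace n | s < |u (x', t)|} < ⊤) :
    regionalEnergy n σ (upperHalf n) (sliceRearr u) ≤
      regionalEnergy n σ (upperHalf n) (fun x => |u x|) := by
  rw [regionalEnergy_eq_lintegral_sliceEnergy n σ (measurable_sliceRearr hu),
    regionalEnergy_eq_lintegral_sliceEnergy n σ hu.abs]
  exact lintegral_mono_ae (ae_fst_ne_snd_levelMeasure.mono fun q hq =>
    sliceEnergy_rearr_le hn hσ hu hfin hq)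

/-- In the case of equality almost every pair of slices has a common centre; comparing all slices
with a fixed nonzero one shows that the centre is the same for all slices. -/
lemma exists_center_of_regionalEnergy_eq (hn : 2 ≤ n) (hσ : 0 < σ) (hu : Measurable u)
    (hfin : ∀ t s : ℝ, 0 < s → volume {x' : HorizSpace n | s < |u (x', t)|} < ⊤)
    (hE : regionalEnergy n σ (upperHalf n) (fun x => |u x|) ≠ ⊤)
    (heq : regionalEnergy n σ (upperHalf n) (fun x => |u x|) =
      regionalEnergy n σ (upperHalf n) (sliceRearr u)) :
    ∃ a : HorizSpace n, ∀ᵐ x ∂(halfMeasure n), |u x| = sliceRearr u (x.1 - a, x.2) := by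
  have := nontrivial_horizSpace hn
  have hU := measurable_sliceRearr hu
  have hw : Measurable fun x => |u x| := hu.abs
  set w : SplitSpace n → ℝ := fun x => |u x|
  have hrearr : ∀ t : ℝ, IsSymmRearr (fun x' : HorizSpace n => w (x', t))
      (fun x' => sliceRearr u (x', t)) := fun t => isSymmRearr_slice hu (hfin t)
  have hpair : ∀ᵐ q ∂(levelMeasure.prod levelMeasure),
      ¬ (fun x' : HorizSpace n => w (x', q.1)) =ᵐ[volume] 0 →
      ¬ (fun x' : HorizSpace n => w (x', q.2)) =ᵐ[volume] 0 →
      ∃ c : HorizSpace n,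
        (fun x' => w (x', q.1)) =ᵐ[volume] (fun x' => sliceRearr u (x' - c, q.1)) ∧
        (fun x' => w (x', q.2)) =ᵐ[volume] (fun x' => sliceRearr u (x' - c, q.2)) := by
    rw [heq] at hE
    rw [regionalEnergy_eq_lintegral_sliceEnergy n σ hU] at heq hE
    rw [regionalEnergy_eq_lintegral_sliceEnergy n σ hw] at heq
    have h1 := ae_eq_of_ae_le_of_lintegral_le (ae_fst_ne_snd_levelMeasure.mono fun q hq =>
      sliceEnergy_rearr_le hn hσ hu hfin hq) hE (measurable_sliceEnergy n σ hw).aemeasurable heq.le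
    have h2 := ae_lt_top (measurable_sliceEnergy n σ hU) hE
    filter_upwards [h1, h2, ae_fst_ne_snd_levelMeasure] with q e1 e2 hq hf0 hg0
    exact exists_center_of_diffEnergy_eq
      (isStrictKernel_sliceKernel (by omega) hσ (sub_ne_zero.2 hq)) (hrearr q.1) (hrearr q.2)
      e2.ne e1.symm hf0 hg0
  have hslices : ∃ a : HorizSpace n, ∀ᵐ t ∂levelMeasure,
      (fun x' => w (x', t)) =ᵐ[volume] (fun x' => sliceRearr u (x' - a, t)) := by
    by_cases hzero : ∀ᵐ t ∂levelMeasure, (fun x' : HorizSpace n => w (x', t)) =ᵐ[volume] 0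
    · exact ⟨0, hzero.mono fun t ht => (hrearr t).ae_eq_of_ae_eq_zero ht 0⟩
    · have hfreq : ∃ᵐ t ∂levelMeasure, ¬ (fun x' : HorizSpace n => w (x', t)) =ᵐ[volume] 0 := by
        rw [Filter.Frequently]
        simpa only [not_not] using hzero
      obtain ⟨s, hs0, hs⟩ := (hfreq.and_eventually (Measure.ae_ae_of_ae_prod hpair)).exists
      obtain ⟨t, ht0, ht⟩ := (hfreq.and_eventually hs).exists
      obtain ⟨a, ha, -⟩ := ht hs0 ht0
      obtain ⟨τ, hτ, hτ0⟩ := exists_level_ne_zero (hrearr s).nonneg_left hs0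
      refine ⟨a, hs.mono fun t ht => ?_⟩
      by_cases ht0 : (fun x' : HorizSpace n => w (x', t)) =ᵐ[volume] 0
      · exact (hrearr t).ae_eq_of_ae_eq_zero ht0 a
      · obtain ⟨c, hc1, hc2⟩ := ht hs0 ht0
        have hca : c = a := by
          refine (hrearr s).center_unique hτ (hτ0 τ le_rfl) ?_
          filter_upwards [hc1.symm.trans ha] with x hx
          exact congrArg (fun r : ℝ => τ < r) hx
        rwa [hca] at hc2
  obtain ⟨a, ha⟩ := hslices
  refine ⟨a, ?_⟩
  have hshift : Measurable fun x : SplitSpace n => sliceRearr u (x.1 - a, x.2) := by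
    have h0 : Measurable fun x : SplitSpace n => ((x.1 - a, x.2) : SplitSpace n) :=
      (measurable_fst.sub_const a).prodMk measurable_snd
    exact hU.comp h0
  have hms : MeasurableSet {x : SplitSpace n | w x = sliceRearr u (x.1 - a, x.2)} :=
    measurableSet_eq_fun hw hshift
  rw [halfMeasure_eq_prod, Measure.ae_prod_iff_ae_ae hms, Measure.ae_ae_comm hms]
  exact ha

lemma regionalEnergy_congr (n : ℕ) (σ : ℝ) {u v : SplitSpace n → ℝ}
    (h : u =ᵐ[halfMeasure n] v) :
    regionalEnergy n σ (upperHalf n) u = regionalEnergy n σ (upperHalf n) v := by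
  refine lintegral_congr_ae (h.mono fun x hx => lintegral_congr_ae (h.mono fun y hy => ?_))
  simp only [hx, hy]

lemma ae_ae_slice {u v : SplitSpace n → ℝ} (h : u =ᵐ[halfMeasure n] v) :
    ∀ᵐ t ∂levelMeasure, (fun x' : HorizSpace n => u (x', t)) =ᵐ[volume] fun x' => v (x', t) := by
  rw [halfMeasure_eq_prod] at h
  exact Measure.ae_ae_of_ae_prod (Measure.measurePreserving_swap.quasiMeasurePreserving.ae h)

lemma ae_snd_of_ae {P : ℝ → Prop} (h : ∀ᵐ t ∂levelMeasure, P t) :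
    ∀ᵐ x ∂(halfMeasure n), P x.2 := by
  rw [halfMeasure_eq_prod]
  exact Measure.quasiMeasurePreserving_snd.ae h

lemma volume_level_congr {u v : SplitSpace n → ℝ} {t : ℝ}
    (h : (fun x' : HorizSpace n => u (x', t)) =ᵐ[volume] fun x' => v (x', t)) (s : ℝ) :
    volume {x' : HorizSpace n | s < |u (x', t)|} =
      volume {x' : HorizSpace n | s < |v (x', t)|} := by
  refine measure_congr (h.mono fun x hx => ?_)
  exact congrArg (fun r : ℝ => s < |r|) hx

/-- The rearrangement depends only on the class of the function modulo null sets. -/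
lemma ae_sliceRearr_eq {u v : SplitSpace n → ℝ} (h : u =ᵐ[halfMeasure n] v) :
    ∀ᵐ t ∂levelMeasure, ∀ x' : HorizSpace n, sliceRearr u (x', t) = sliceRearr v (x', t) := by
  filter_upwards [ae_ae_slice h] with t ht x'
  rw [sliceRearr, sliceRearr, symmDecrRearr_congr (volume_level_congr ht)]

/-- By Chebyshev's inequality and Fubini's theorem, almost all slices of a function in a Lebesgue
space have superlevel sets of finite measure. -/
lemma ae_volume_level_lt_top {v : SplitSpace n → ℝ} (hv : Measurable v) {p : ℝ≥0∞} (hp0 : p ≠ 0)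
    (hp : p ≠ ⊤) (hLp : MemLp v p (halfMeasure n)) :
    ∀ᵐ t ∂levelMeasure, ∀ k : ℕ,
      volume {x' : HorizSpace n | 1 / ((k : ℝ) + 1) < |v (x', t)|} < ⊤ := by
  rw [ae_all_iff]
  intro k
  have hpos : (0 : ℝ) < 1 / ((k : ℝ) + 1) := by positivity
  have hms : MeasurableSet {x : SplitSpace n | 1 / ((k : ℝ) + 1) < |v x|} :=
    measurableSet_lt measurable_const hv.abs
  have h1 : halfMeasure n {x : SplitSpace n | 1 / ((k : ℝ) + 1) < |v x|} ≠ ⊤ := by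
    have h2 := meas_ge_le_mul_pow_eLpNorm_enorm (halfMeasure n) hp0 hp hLp.1
      (ε := ENNReal.ofReal (1 / ((k : ℝ) + 1))) (by simpa using hpos) (by simp)
    refine ne_top_of_le_ne_top ?_ ((measure_mono fun x hx => ?_).trans h2)
    · refine ENNReal.mul_ne_top (ENNReal.rpow_ne_top_of_nonneg ENNReal.toReal_nonneg ?_) ?_
      · exact ENNReal.inv_ne_top.2 (by simpa using hpos)
      · exact ENNReal.rpow_ne_top_of_nonneg ENNReal.toReal_nonneg hLp.2.ne
    · have hx' : 1 / ((k : ℝ) + 1) < |v x| := hx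
      rw [mem_ofPred_eq, ← ofReal_norm, Real.norm_eq_abs]
      exact ENNReal.ofReal_le_ofReal hx'.le
  rw [halfMeasure_eq_prod, Measure.prod_apply_symm hms] at h1
  exact ae_lt_top (measurable_measure_prodMk_right hms) h1

/-- A function in a Lebesgue space on the half space has a Borel representative all of whose slices
have superlevel sets of finite measure. -/
lemma exists_measurable_representative {u : SplitSpace n → ℝ} {p : ℝ≥0∞} (hp0 : p ≠ 0)
    (hp : p ≠ ⊤) (hLp : MemLp u p (halfMeasure n)) :
    ∃ v : SplitSpace n → ℝ, Measurable v ∧ u =ᵐ[halfMeasure n] v ∧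
      ∀ t s : ℝ, 0 < s → volume {x' : HorizSpace n | s < |v (x', t)|} < ⊤ := by
  obtain ⟨v₀, hv₀, huv₀⟩ := hLp.1
  have hm₀ : Measurable v₀ := hv₀.measurable
  have hae := ae_volume_level_lt_top hm₀ hp0 hp ((memLp_congr_ae huv₀).1 hLp)
  set G : Set ℝ := {t | ∀ k : ℕ,
    volume {x' : HorizSpace n | 1 / ((k : ℝ) + 1) < |v₀ (x', t)|} < ⊤} with hGdef
  have hG : MeasurableSet G := by
    rw [hGdef]
    have h1 : ∀ k : ℕ, Measurable fun t : ℝ =>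
        volume {x' : HorizSpace n | 1 / ((k : ℝ) + 1) < |v₀ (x', t)|} := fun k => by
      have hms : MeasurableSet {x : SplitSpace n | 1 / ((k : ℝ) + 1) < |v₀ x|} :=
        measurableSet_lt measurable_const hm₀.abs
      exact measurable_measure_prodMk_right hms
    have h2 : {t : ℝ | ∀ k : ℕ,
        volume {x' : HorizSpace n | 1 / ((k : ℝ) + 1) < |v₀ (x', t)|} < ⊤} =
        ⋂ k : ℕ, {t : ℝ |
          volume {x' : HorizSpace n | 1 / ((k : ℝ) + 1) < |v₀ (x', t)|} < ⊤} := by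
      ext t
      simp
    rw [h2]
    exact MeasurableSet.iInter fun k => measurableSet_lt (h1 k) measurable_const
  refine ⟨(Prod.snd ⁻¹' G).indicator v₀, hm₀.indicator (measurable_snd hG), ?_, ?_⟩
  · filter_upwards [huv₀, ae_snd_of_ae (n := n) hae] with x hx hxG
    rw [hx, indicator_of_mem (by exact hxG)]
  · intro t s hs
    by_cases ht : t ∈ G
    · obtain ⟨k, hk⟩ := exists_nat_one_div_lt hs
      refine (measure_mono fun x' hx' => ?_).trans_lt (ht k)
      have hx'' : s < |(Prod.snd ⁻¹' G).indicator v₀ (x', t)| := hx'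
      rw [indicator_of_mem (by exact ht)] at hx''
      exact hk.trans hx''
    · have : {x' : HorizSpace n | s < |(Prod.snd ⁻¹' G).indicator v₀ (x', t)|} = ∅ := by
        refine eq_empty_of_forall_notMem fun x' hx' => ?_
        have hx'' : s < |(Prod.snd ⁻¹' G).indicator v₀ (x', t)| := hx'
        rw [indicator_of_notMem (by exact ht), abs_zero] at hx''
        exact (hs.trans hx'').false
      simp [this]

end HalfSpace

end

theorem proposition2p1 (n : ℕ) (hn : 2 ≤ n) (σ : ℝ) (hσ : σ ∈ Set.Ioo (0 : ℝ) 1)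
    (u : SplitSpace n → ℝ) (hu : MemHRing n σ u) :
    -- the rearrangement is well defined and measurable
    (∀ᵐ t ∂(volume.restrict (Set.Ioi (0 : ℝ))), ∀ s : ℝ, 0 < s →
      volume {x' : HorizSpace n | s < |u (x', t)|} < ⊤) ∧
    AEMeasurable (sliceRearr u) (volume.restrict (upperHalf n)) ∧
    -- the rearrangement inequality
    regionalEnergy n σ (upperHalf n) (sliceRearr u) ≤ regionalEnergy n σ (upperHalf n) u ∧
    -- the case of equality
    (regionalEnergy n σ (upperHalf n) u = regionalEnergy n σ (upperHalf n) (sliceRearr u) →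
      ∃ a : HorizSpace n,
        (∀ᵐ x ∂(volume.restrict (upperHalf n)), u x = sliceRearr u (x.1 - a, x.2)) ∨
        (∀ᵐ x ∂(volume.restrict (upperHalf n)), u x = -sliceRearr u (x.1 - a, x.2))) := by
  have hn' : (2 : ℝ) ≤ n := by exact_mod_cast hn
  have hp : 0 < 2 * (n : ℝ) / ((n : ℝ) - 2 * σ) :=
    div_pos (by linarith) (by linarith [hσ.2])
  obtain ⟨v, hv, huv, hfin⟩ := exists_measurable_representative (by simpa using hp)
    ENNReal.ofReal_ne_top hu.memLp
  have hsl := ae_sliceRearr_eq huv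
  have hUV : sliceRearr u =ᵐ[halfMeasure n] sliceRearr v :=
    (ae_snd_of_ae (n := n) hsl).mono fun x hx => hx x.1
  have hEu := regionalEnergy_congr n σ huv
  have hEU := regionalEnergy_congr n σ hUV
  have h1 := regionalEnergy_sliceRearr_le hn hσ.1 hv hfin
  have h2 := regionalEnergy_abs_le n σ v
  refine ⟨?_, ⟨sliceRearr v, measurable_sliceRearr hv, hUV⟩, ?_, fun heq => ?_⟩
  · filter_upwards [ae_ae_slice huv] with t ht s hs
    rw [volume_level_congr ht]
    exact hfin t s hs
  · rw [hEu, hEU]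
    exact h1.trans h2
  · have hvfin : regionalEnergy n σ (upperHalf n) v ≠ ⊤ := hEu ▸ hu.energy_lt_top.ne
    rw [hEu, hEU] at heq
    have e1 : regionalEnergy n σ (upperHalf n) (fun x => |v x|) =
        regionalEnergy n σ (upperHalf n) v := le_antisymm h2 (heq.trans_le h1)
    obtain ⟨a, ha⟩ := exists_center_of_regionalEnergy_eq hn hσ.1 hv hfin (e1 ▸ hvfin)
      (e1.trans heq)
    refine ⟨a, ?_⟩
    have hsl' := ae_snd_of_ae (n := n) hsl
    rcases ae_abs_eq_or_of_regionalEnergy_eq hv hvfin e1.symm with h | h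
    · left
      filter_upwards [huv, ha, h, hsl'] with x x1 x2 x3 x4
      rw [x1, x3, x2, x4]
    · right
      filter_upwards [huv, ha, h, hsl'] with x x1 x2 x3 x4
      rw [x1, x3, x2, x4]
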